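/- Let $(W,S)$, $S=\{s_i\}_{i\in I}$, be a Coxeter system with $W$ finite, let $D$ be its Coxeter graph (vertex set $I$, with $i\neq j$ joined when $m_{ij}\neq 2$), fix a total order on $I$, and let $k$ be a field of characteristic $0$. Subdiagrams of $D$ are non-empty full subgraphs, identified with their vertex sets; $B,B',C$ below denote connected subdiagrams. Let $W_B\subseteq W$ be generated by $\{s_i\}_{i\in B}$, let $W$ act on $kW$ by conjugation, and let $\varepsilon:W\to\{\pm1\}$ be the sign character ($\varepsilon(s_i)=-1$). The Dynkin complex $CD=CD(kW)$ is $$CD^p=\bigoplus_{\alpha\subseteq B\subseteq D,\ |\alpha|=p}(kW_B)^{W_{B\setminus\alpha}}\qquad(p\ge 0),$$ with differential given, for $\alpha=\{\alpha_1<\dots<\alpha_{p+1}\}\subseteq B$, by $$(d_Da)_{(B;\alpha)}=\sum_{i=1}^{p+1}(-1)^{i-1}\Big(a_{(B;\alpha\setminus\alpha_i)}-\sum_{C}a_{(C;\alpha\setminus\alpha_i)}\Big),$$ where $C$ runs over the connected components of $B\setminus\alpha_i$ that contain $\alpha\setminus\alpha_i$ (at most one if $p\geq 1$; all components if $p=0$).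 Let $kW_B^\varepsilon\subseteq kW_B$ be the subspace on which $W_B$ acts, by conjugation, through $\varepsilon$, and let $$\mathrm{Alt}_B:kW_B\to kW_B^\varepsilon,\qquad \mathrm{Alt}_B(f)=\frac1{|W_B|}\sum_{w\in W_B}\varepsilon(w)\,wfw^{-1}.$$ Let $HC=\bigoplus_{B}kW_B^\varepsilon$, with $kW_B^\varepsilon$ in degree $|B|$, and $$d^\#=\sum_{B'}(-1)^{(B';B)}\,\mathrm{Alt}_{B'}:\ kW_B^\varepsilon\to\bigoplus_{B'\supset B,\ |B'|=|B|+1}kW_{B'}^\varepsilon,$$ where, if $B'=\{\alpha_1<\dots<\alpha_q\}$ and $B'\setminus B=\{\alpha_i\}$, one sets $(B';B)=i$. Then $\mathrm{Alt}_B$ vanishes on $(kW_B)^{W_{B\setminus\alpha}}$ whenever $\alpha\subsetneq B$, so that the map $\phi:CD\to HC$ sending $a\in (kW_B)^{W_{B\setminus\alpha}}$ to $\mathrm{Alt}_B(a)$ preserves degrees; $(CD,d_D)$ and $(HC,d^\#)$ are complexes; and $\phi$ is a morphism of complexes and a quasi-isomorphism. -/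

import Mathlib

open CategoryTheory

noncomputable section

/-- The Coxeter graph of a Coxeter matrix: `i` and `j` are joined when `m(i,j) ≠ 2`, that is
`m(i,j) ≥ 3` or `m(i,j) = ∞` (encoded in Mathlib as `0`). -/
def CoxeterMatrix.coxeterGraph {I : Type*} (M : CoxeterMatrix I) : SimpleGraph I where
  Adj i j := i ≠ j ∧ M i j ≠ 2
  symm := ⟨fun i j h => ⟨h.1.symm, by rw [M.symmetric]; exact h.2⟩⟩
  loopless := ⟨fun _ h => h.1 rfl⟩

namespace CoxeterMatrix

variable {I : Type*} (M : CoxeterMatrix I)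

/-- The (non-empty) connected subdiagrams of the Coxeter graph, given by their vertex sets. -/
def IsConnectedSubdiagram (B : Finset I) : Prop :=
  (M.coxeterGraph.induce (B : Set I)).Connected

/-- `C` is (the vertex set of) a connected component of the full subgraph with vertex set `X`:
it is a connected subdiagram of `X` and no edge joins it to the rest of `X`. -/
def IsComponent (C X : Finset I) : Prop :=
  C ⊆ X ∧ M.IsConnectedSubdiagram C ∧
    ∀ i ∈ C, ∀ j ∈ X, j ∉ C → ¬ M.coxeterGraph.Adj i j

/-- The pairs `(B; α)` with `B` a connected subdiagram and `α ⊆ B` of cardinality `p`. -/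
abbrev DynkinIndex (p : ℕ) : Type _ :=
  {x : Finset I × Finset I // M.IsConnectedSubdiagram x.1 ∧ x.2 ⊆ x.1 ∧ x.2.card = p}

/-- The connected subdiagrams `B` with `|B| = p`. -/
abbrev SubdiagramIndex (p : ℕ) : Type _ :=
  {B : Finset I // M.IsConnectedSubdiagram B ∧ B.card = p}

end CoxeterMatrix

namespace CoxeterSystem

variable {I : Type*} {W : Type*} [Group W] {M : CoxeterMatrix I} (cs : CoxeterSystem M W)
variable (k : Type*) [Field k]

/-- The standard parabolic subgroup `W_B`, generated by the `s_i` with `i ∈ B`. -/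
def parabolic (B : Finset I) : Subgroup W :=
  Subgroup.closure (cs.simple '' (B : Set I))

/-- The sign character `ε : W → {±1}`, with `ε(s_i) = -1` for all `i`. -/
def sign : W →* ℤˣ :=
  cs.lift ⟨fun _ => -1, fun i j => by simp⟩

theorem sign_simple (i : I) : cs.sign (cs.simple i) = -1 :=
  cs.lift_apply_simple (f := fun _ => (-1 : ℤˣ)) (fun i j => by simp) i

/-- The group algebra `k W_B`, as a subspace of `k W`. -/
def parabolicAlgebra (B : Finset I) : Submodule k (MonoidAlgebra k W) :=
  MonoidAlgebra.supported k k (cs.parabolic B : Set W)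

end CoxeterSystem

namespace CoxeterDynkin

/-- The adjoint action `f ↦ w f w⁻¹` of `w ∈ W` on `k W`. -/
def conj {W : Type*} [Group W] (k : Type*) [Field k] (w : W) :
    MonoidAlgebra k W →ₗ[k] MonoidAlgebra k W :=
  (LinearMap.mulLeft k (MonoidAlgebra.of k W w)) ∘ₗ
    (LinearMap.mulRight k (MonoidAlgebra.of k W w⁻¹))

section Action

variable {W : Type*} [Group W] {k : Type*} [Field k]

theorem conj_apply (w : W) (f : MonoidAlgebra k W) :
    conj k w f = MonoidAlgebra.of k W w * (f * MonoidAlgebra.of k W w⁻¹) := rfl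

theorem conj_mul (v w : W) (f : MonoidAlgebra k W) : conj k (v * w) f = conj k v (conj k w f) := by
  simp only [conj_apply, mul_inv_rev, map_mul, mul_assoc]

theorem conj_single (w g : W) (r : k) :
    conj k w (MonoidAlgebra.single g r) = MonoidAlgebra.single (w * g * w⁻¹) r := by
  simp [conj_apply, MonoidAlgebra.of_apply, MonoidAlgebra.single_mul_single, mul_assoc]

theorem conj_one (f : MonoidAlgebra k W) : conj k (1 : W) f = f := by
  rw [conj_apply, inv_one, map_one, one_mul, mul_one]

theorem conj_inv_of_fixed {w : W} {f : MonoidAlgebra k W} (h : conj k w f = f) :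
    conj k w⁻¹ f = f := by
  conv_lhs => rw [← h]
  rw [← conj_mul, inv_mul_cancel, conj_one]

/-- The elements of `k W` fixed by `w` for all `w` in a generating set are fixed by the subgroup. -/
theorem conj_fixed_of_closure {T : Set W} {f : MonoidAlgebra k W}
    (h : ∀ t ∈ T, conj k t f = f) : ∀ w ∈ Subgroup.closure T, conj k w f = f := by
  intro w hw
  induction hw using Subgroup.closure_induction with
  | mem t ht => exact h t ht
  | one => exact conj_one f
  | mul x y _ _ hx hy => rw [conj_mul, hy, hx]
  | inv x _ hx => exact conj_inv_of_fixed hx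

/-- Elements supported on elements commuting with `w` are fixed by `w`. -/
theorem conj_eq_self_of_commute {H : Subgroup W} {w : W} (hc : ∀ g ∈ H, w * g = g * w)
    {f : MonoidAlgebra k W} (hf : f ∈ MonoidAlgebra.supported k k (H : Set W)) :
    conj k w f = f := by
  rw [MonoidAlgebra.supported_eq_span_single] at hf
  induction hf using Submodule.span_induction with
  | mem x hx =>
    obtain ⟨g, hg, rfl⟩ := hx
    rw [conj_single, hc g hg, mul_inv_cancel_right]
  | zero => simp
  | add x y _ _ hx hy => rw [map_add, hx, hy]
  | smul a x _ hx => rw [map_smul, hx]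

theorem conj_mem_supported {H : Subgroup W} {w : W} (hw : w ∈ H)
    {f : MonoidAlgebra k W} (hf : f ∈ MonoidAlgebra.supported k k (H : Set W)) :
    conj k w f ∈ MonoidAlgebra.supported k k (H : Set W) := by
  rw [MonoidAlgebra.supported_eq_span_single] at hf ⊢
  induction hf using Submodule.span_induction with
  | mem x hx =>
    obtain ⟨g, hg, rfl⟩ := hx
    rw [conj_single]
    exact Submodule.subset_span ⟨_, H.mul_mem (H.mul_mem hw hg) (H.inv_mem hw), rfl⟩
  | zero => simp
  | add x y _ _ hx hy => rw [map_add]; exact add_mem hx hy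
  | smul a x _ hx => rw [map_smul]; exact Submodule.smul_mem _ _ hx

end Action

end CoxeterDynkin

namespace CoxeterSystem

open CoxeterDynkin

variable {I : Type*} {W : Type*} [Group W] {M : CoxeterMatrix I} (cs : CoxeterSystem M W)
variable (k : Type*) [Field k]

/-- The space `(k W_B)^{W_X}` of elements of `k W_B` fixed by the adjoint action of `W_X`. -/
def fixedPart (B X : Finset I) : Submodule k (MonoidAlgebra k W) where
  carrier := {f | f ∈ cs.parabolicAlgebra k B ∧ ∀ w ∈ cs.parabolic X, conj k w f = f}
  zero_mem' := ⟨zero_mem _, fun _ _ => map_zero _⟩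
  add_mem' ha hb := ⟨add_mem ha.1 hb.1, fun w hw => by rw [map_add, ha.2 w hw, hb.2 w hw]⟩
  smul_mem' c _ ha := ⟨Submodule.smul_mem _ c ha.1, fun w hw => by rw [map_smul, ha.2 w hw]⟩

/-- The space `(k W_B)^ε` of elements of `k W_B` on which `W_B` acts, by the adjoint action,
through the sign character. -/
def signPart (B : Finset I) : Submodule k (MonoidAlgebra k W) where
  carrier := {f | f ∈ cs.parabolicAlgebra k B ∧
    ∀ w ∈ cs.parabolic B, conj k w f = (((cs.sign w : ℤˣ) : ℤ) : k) • f}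
  zero_mem' := ⟨zero_mem _, fun _ _ => by simp⟩
  add_mem' ha hb := ⟨add_mem ha.1 hb.1,
    fun w hw => by rw [map_add, ha.2 w hw, hb.2 w hw, smul_add]⟩
  smul_mem' c _ ha := ⟨Submodule.smul_mem _ c ha.1,
    fun w hw => by rw [map_smul, ha.2 w hw, smul_comm]⟩

theorem parabolic_mono {B C : Finset I} (h : B ⊆ C) : cs.parabolic B ≤ cs.parabolic C :=
  Subgroup.closure_mono (Set.image_mono (by exact_mod_cast h))

theorem parabolicAlgebra_mono {B C : Finset I} (h : B ⊆ C) :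
    cs.parabolicAlgebra k B ≤ cs.parabolicAlgebra k C :=
  MonoidAlgebra.supported_mono (cs.parabolic_mono h)

theorem fixedPart_mono {B B' X X' : Finset I} (hB : B ⊆ B') (hX : X' ⊆ X) :
    cs.fixedPart k B X ≤ cs.fixedPart k B' X' :=
  fun _ hf => ⟨cs.parabolicAlgebra_mono k hB hf.1, fun w hw => hf.2 w (cs.parabolic_mono hX hw)⟩

theorem simple_commute_of_not_adj {i j : I} (h : ¬ M.coxeterGraph.Adj i j) :
    cs.simple j * cs.simple i = cs.simple i * cs.simple j := by
  by_cases hij : i = j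
  · subst hij; rfl
  · have h2 : M i j = 2 := by
      by_contra h2
      exact h ⟨hij, h2⟩
    have h3 := cs.simple_mul_simple_pow i j
    rw [h2, pow_two] at h3
    have h4 := eq_inv_of_mul_eq_one_left h3
    rw [mul_inv_rev, cs.inv_simple, cs.inv_simple] at h4
    exact h4.symm

theorem commute_parabolic {C : Finset I} {j : I} (h : ∀ i ∈ C, ¬ M.coxeterGraph.Adj i j) :
    ∀ g ∈ cs.parabolic C, cs.simple j * g = g * cs.simple j := by
  intro g hg
  have hle : cs.parabolic C ≤ Subgroup.centralizer {cs.simple j} := by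
    refine (Subgroup.closure_le _).2 ?_
    rintro _ ⟨i, hi, rfl⟩
    rw [SetLike.mem_coe, Subgroup.mem_centralizer_singleton_iff]
    exact (cs.simple_commute_of_not_adj (h i hi)).symm
  have := hle hg
  rw [Subgroup.mem_centralizer_singleton_iff] at this
  exact this.symm

/-- If `C` is a component of `X`, then `(k W_C)^{W_{C ∖ γ}} ⊆ (k W_X)^{W_{X ∖ γ}}`. -/
theorem fixedPart_component [DecidableEq I] {C X γ : Finset I} (hC : M.IsComponent C X) :
    cs.fixedPart k C (C \ γ) ≤ cs.fixedPart k X (X \ γ) := by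
  intro f hf
  refine ⟨cs.parabolicAlgebra_mono k hC.1 hf.1, conj_fixed_of_closure ?_⟩
  rintro _ ⟨j, hj, rfl⟩
  have hj' : j ∈ X \ γ := by exact_mod_cast hj
  rw [Finset.mem_sdiff] at hj'
  by_cases hjC : j ∈ C
  · exact hf.2 _ (Subgroup.subset_closure
      ⟨j, by exact_mod_cast Finset.mem_sdiff.2 ⟨hjC, hj'.2⟩, rfl⟩)
  · exact conj_eq_self_of_commute
      (cs.commute_parabolic fun i hi => hC.2.2 i hi j hj'.1 hjC) hf.1

section Antisymmetrisation

variable [Fintype W]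

open scoped Classical in
/-- The antisymmetrisation `Alt_B(f) = |W_B|⁻¹ ∑_{w ∈ W_B} ε(w) w f w⁻¹`. -/
def Alt (B : Finset I) : MonoidAlgebra k W →ₗ[k] MonoidAlgebra k W :=
  (Nat.card (cs.parabolic B) : k)⁻¹ •
    ∑ w : cs.parabolic B, (((cs.sign (w : W) : ℤˣ) : ℤ) : k) • conj k (w : W)

theorem Alt_mem (B : Finset I) {f : MonoidAlgebra k W} (hf : f ∈ cs.parabolicAlgebra k B) :
    Alt cs k B f ∈ cs.signPart k B := by
  classical
  have key : ∀ v : cs.parabolic B,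
      conj k (v : W) (∑ w : cs.parabolic B, (((cs.sign (w : W) : ℤˣ) : ℤ) : k) • conj k (w : W) f)
        = (((cs.sign (v : W) : ℤˣ) : ℤ) : k) •
          ∑ w : cs.parabolic B, (((cs.sign (w : W) : ℤˣ) : ℤ) : k) • conj k (w : W) f := by
    intro v
    rw [map_sum, Finset.smul_sum]
    refine Fintype.sum_equiv (Equiv.mulLeft v) _ _ fun w => ?_
    have hs : (((cs.sign (v : W) : ℤˣ) : ℤ) : k) * (((cs.sign (v : W) : ℤˣ) : ℤ) : k) = 1 := by
      rw [← Int.cast_mul, ← Units.val_mul, Int.units_mul_self, Units.val_one, Int.cast_one]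
    rw [map_smul, Equiv.coe_mulLeft, Subgroup.coe_mul, map_mul, CoxeterDynkin.conj_mul, smul_smul,
      Units.val_mul, Int.cast_mul, ← mul_assoc, hs, one_mul]
  simp only [Alt, LinearMap.smul_apply, LinearMap.sum_apply]
  refine Submodule.smul_mem _ _ ⟨Submodule.sum_mem _ fun w _ => Submodule.smul_mem _ _ ?_, ?_⟩
  · exact conj_mem_supported w.2 hf
  · intro w hw
    exact key ⟨w, hw⟩

end Antisymmetrisation

section Complexes

/-- `HC^p = ⨁_{|B| = p} (k W_B)^ε`, the sum running over the connected subdiagrams `B`. -/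
abbrev HC (p : ℕ) : Type _ :=
  (B : M.SubdiagramIndex p) → cs.signPart k B.1

open scoped Classical in
/-- The component `b_B ∈ k W` of an element of `HC^p`, read as `0` when `B` is not an index of
`HC^p`. -/
def HCcomp (p : ℕ) (B : Finset I) : HC cs k p →ₗ[k] MonoidAlgebra k W :=
  if h : M.IsConnectedSubdiagram B ∧ B.card = p then
    (cs.signPart k B).subtype ∘ₗ LinearMap.proj (⟨B, h⟩ : M.SubdiagramIndex p)
  else 0

theorem HCcomp_mem (p : ℕ) (B : Finset I) (b : HC cs k p) :
    HCcomp cs k p B b ∈ cs.signPart k B := by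
  by_cases h : M.IsConnectedSubdiagram B ∧ B.card = p
  · rw [HCcomp, dif_pos h]
    exact (b ⟨B, h⟩).2
  · rw [HCcomp, dif_neg h]
    exact zero_mem _

variable [LinearOrder I]

/-- The Dynkin `p`-cochains `CD^p = ⨁_{(B; α), |α| = p} (k W_B)^{W_{B ∖ α}}` (the index set is
finite, so that the direct sum is the product). -/
abbrev CD (p : ℕ) : Type _ :=
  (x : M.DynkinIndex p) → cs.fixedPart k x.1.1 (x.1.1 \ x.1.2)

open scoped Classical in
/-- The component `a_{(B; α)} ∈ k W` of a Dynkin `p`-cochain, read as `0` when `(B; α)` is not an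
index of `CD^p`. -/
def CDcomp (p : ℕ) (B α : Finset I) : CD cs k p →ₗ[k] MonoidAlgebra k W :=
  if h : M.IsConnectedSubdiagram B ∧ α ⊆ B ∧ α.card = p then
    (cs.fixedPart k B (B \ α)).subtype ∘ₗ LinearMap.proj (⟨(B, α), h⟩ : M.DynkinIndex p)
  else 0

theorem CDcomp_mem (p : ℕ) (B α : Finset I) (a : CD cs k p) :
    CDcomp cs k p B α a ∈ cs.fixedPart k B (B \ α) := by
  by_cases h : M.IsConnectedSubdiagram B ∧ α ⊆ B ∧ α.card = p
  · rw [CDcomp, dif_pos h]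
    exact (a ⟨(B, α), h⟩).2
  · rw [CDcomp, dif_neg h]
    exact zero_mem _

open scoped Classical in
/-- The component along `(B; α)` of the Dynkin differential: if `α = {α_1 < ⋯ < α_{p+1}}`, it is
`∑_i (-1)^{i-1} (a_{(B; α ∖ α_i)} - ∑_C a_{(C; α ∖ α_i)})`, where `C` runs over the connected
components of `B ∖ α_i` containing `α ∖ α_i`. There is at most one such `C` if `p ≥ 1`, and all
the components of `B ∖ α_1` occur if `p = 0`. The number of elements of `α` below `α_i` is
`i - 1`. -/
def dCDcomp (p : ℕ) (B α : Finset I) : CD cs k p →ₗ[k] MonoidAlgebra k W :=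
  ∑ β ∈ α, (-1 : k) ^ (α.filter (· < β)).card •
    (CDcomp cs k p B (α.erase β) -
      ∑ C ∈ (B.erase β).powerset.filter
          (fun C => M.IsComponent C (B.erase β) ∧ α.erase β ⊆ C),
        CDcomp cs k p C (α.erase β))

theorem dCDcomp_mem (p : ℕ) (B α : Finset I) (a : CD cs k p) :
    dCDcomp cs k p B α a ∈ cs.fixedPart k B (B \ α) := by
  classical
  simp only [dCDcomp, LinearMap.sum_apply, LinearMap.smul_apply, LinearMap.sub_apply]
  refine Submodule.sum_mem _ fun β hβ => Submodule.smul_mem _ _ (Submodule.sub_mem _ ?_ ?_)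
  · exact cs.fixedPart_mono k subset_rfl (Finset.sdiff_subset_sdiff subset_rfl
      (Finset.erase_subset _ _)) (CDcomp_mem cs k p B _ a)
  · refine Submodule.sum_mem _ fun C hC => ?_
    rw [Finset.mem_filter] at hC
    refine cs.fixedPart_mono k (Finset.erase_subset _ _) ?_
      (cs.fixedPart_component k hC.2.1 (CDcomp_mem cs k p C _ a))
    intro j hj
    rw [Finset.mem_sdiff] at hj
    simp only [Finset.mem_sdiff, Finset.mem_erase]
    exact ⟨⟨fun h => hj.2 (h ▸ hβ), hj.1⟩, fun h => hj.2 h.2⟩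

/-- The Dynkin differential `d_D : CD^p → CD^{p+1}`. -/
def dCD (p : ℕ) : CD cs k p →ₗ[k] CD cs k (p + 1) :=
  LinearMap.pi fun x =>
    (dCDcomp cs k p x.1.1 x.1.2).codRestrict _ (dCDcomp_mem cs k p x.1.1 x.1.2)

variable [Fintype W]

/-- The component along `B` of the differential of `HC`: if `B = {α_1 < ⋯ < α_q}`, it is
`∑_i (-1)^i Alt_B(b_{B ∖ α_i})`, the sum running over the `i` with `B ∖ α_i` a connected
subdiagram. The number of elements of `B` up to and including `α_i` is `i`. -/
def dHCcomp (p : ℕ) (B : Finset I) : HC cs k p →ₗ[k] MonoidAlgebra k W :=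
  ∑ β ∈ B, (-1 : k) ^ (B.filter (· ≤ β)).card •
    (Alt cs k B ∘ₗ HCcomp cs k p (B.erase β))

theorem dHCcomp_mem (p : ℕ) (B : Finset I) (b : HC cs k p) :
    dHCcomp cs k p B b ∈ cs.signPart k B := by
  simp only [dHCcomp, LinearMap.sum_apply, LinearMap.smul_apply]
  refine Submodule.sum_mem _ fun β _ => Submodule.smul_mem _ _ (Alt_mem cs k B ?_)
  exact cs.parabolicAlgebra_mono k (Finset.erase_subset _ _) (HCcomp_mem cs k p _ b).1

/-- The differential `d^# : HC^p → HC^{p+1}`. -/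
def dHC (p : ℕ) : HC cs k p →ₗ[k] HC cs k (p + 1) :=
  LinearMap.pi fun B => (dHCcomp cs k p B.1).codRestrict _ (dHCcomp_mem cs k p B.1)

/-- The map `φ : CD^p → HC^p`. Among the components `(B; α)` with `|α| = p`, those that are sent
to degree `|B| = p` of `HC` are the ones with `α = B`; the components with `α ≠ B` have zero
antisymmetrisation (this vanishing is part of the theorem). -/
def phi (p : ℕ) : CD cs k p →ₗ[k] HC cs k p :=
  LinearMap.pi fun B =>
    (Alt cs k B.1 ∘ₗ CDcomp cs k p B.1 B.1).codRestrict _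
      fun a => Alt_mem cs k B.1 (CDcomp_mem cs k p B.1 B.1 a).1

/-- The Dynkin complex of `k W`, as a cochain complex of `k`-modules. -/
def CDcomplex (h : ∀ p, dCD cs k (p + 1) ∘ₗ dCD cs k p = 0) : CochainComplex (ModuleCat k) ℕ :=
  CochainComplex.of (fun p => ModuleCat.of k (CD cs k p)) (fun p => ModuleCat.ofHom (dCD cs k p))
    fun p => by rw [← ModuleCat.ofHom_comp, h p]; rfl

/-- The complex `(HC, d^#)`, as a cochain complex of `k`-modules. -/
def HCcomplex (h : ∀ p, dHC cs k (p + 1) ∘ₗ dHC cs k p = 0) : CochainComplex (ModuleCat k) ℕ :=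
  CochainComplex.of (fun p => ModuleCat.of k (HC cs k p)) (fun p => ModuleCat.ofHom (dHC cs k p))
    fun p => by rw [← ModuleCat.ofHom_comp, h p]; rfl

/-- The map `φ`, as a morphism of complexes. -/
def phiHom (hCD : ∀ p, dCD cs k (p + 1) ∘ₗ dCD cs k p = 0)
    (hHC : ∀ p, dHC cs k (p + 1) ∘ₗ dHC cs k p = 0)
    (hφ : ∀ p, phi cs k (p + 1) ∘ₗ dCD cs k p = dHC cs k p ∘ₗ phi cs k p) :
    CDcomplex cs k hCD ⟶ HCcomplex cs k hHC :=
  CochainComplex.ofHom (X := CDcomplex cs k hCD) (Y := HCcomplex cs k hHC)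
    (fun p => ModuleCat.ofHom (phi cs k p)) fun p => by
      have h₁ := CochainComplex.of_d (fun p => ModuleCat.of k (CD cs k p))
        (fun p => ModuleCat.ofHom (dCD cs k p)) p
      have h₂ := CochainComplex.of_d (fun p => ModuleCat.of k (HC cs k p))
        (fun p => ModuleCat.ofHom (dHC cs k p)) p
      have h₃ : ModuleCat.ofHom (phi cs k p) ≫ ModuleCat.ofHom (dHC cs k p) =
          ModuleCat.ofHom (dCD cs k p) ≫ ModuleCat.ofHom (phi cs k (p + 1)) := by
        rw [← ModuleCat.ofHom_comp, ← ModuleCat.ofHom_comp, hφ p]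
      rw [← h₁, ← h₂] at h₃
      exact h₃

end Complexes

end CoxeterSystem

end

/-!
The map `φ` is surjective in each degree, since `Alt_B` is a projection of `k W_B` onto the part on
which `W_B` acts by the sign. So it suffices to show that the kernel of `φ` is acyclic
(`quasiIso_of_surjective_of_acyclic_ker`). The components of the Dynkin differential that change
`B` lead from smaller to larger subdiagrams, so filtering by the number of vertices of `B` leaves,
for each connected `B`, the complex
`⨁_{α ⊆ B, |α| = p} V^{W_{B ∖ α}}` with the alternating sum of the inclusions as its differential,
where `V = k W_B`. This is the Coxeter complex of `W_B` with coefficients in `V`. A cocycle in the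
kernel of `φ` is reduced to zero by correcting it on the subdiagrams with `n` vertices, for
`n = 0, 1, 2, …` (`CoxeterSystem.exists_dCD_eq_of_phi_eq_zero`).

The Coxeter complex is exact below the top degree `p = |B|`. By averaging, `V` is a retract of the
module of functions from `W` to `V`, so it is enough to treat these functions; there `V^{W_J}`
becomes the space of functions constant on the cosets `w W_J`. A cocycle is cleared length by length
(`CoxeterSystem.IsCosetCochain.exists_coboundary_step`). If it vanishes on the elements shorter than
`w`, its value at `(α, w)` vanishes unless `w` has no right descents in `B ∖ α`. If `B` contains a
vertex `i` that is not a right descent of `w`, then adding `i` to the sets `α` contracts the part of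
the cocycle at `w`; if there is none, only the top degree occurs. The contraction extends to
functions constant on cosets because an element without right descents in `J` is the unique shortest
element of `w W_J` (`CoxeterSystem.length_lt_length_mul_of_not_isRightDescent`), which follows from
the exchange condition. In the top degree, `v ≡ Alt_B v` modulo the sum of the spaces `V^{s_i}`,
because `v + s_i v` is fixed by `s_i`; so the elements killed by `Alt_B` are coboundaries.

That `d_D` squares to zero comes down to the symmetry in `β` and `γ` of the terms in which these two
vertices are removed. This holds since the components of `Y ∖ γ` are the components of `Y` without
`γ` and those of `C ∖ γ`, for `C` the component of `γ` (`CoxeterMatrix.sum_components_erase`). For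
`d^#`, the symmetry could only fail if `B ∖ β` is disconnected although `B ∖ {β, γ}` is connected;
then `s_γ` centralises `W_{B ∖ {β, γ}}` and `Alt_B` kills its group algebra.
-/

noncomputable section

/-! ### The exchange condition and shortest coset representatives -/

namespace CoxeterSystem

variable {I : Type*} {W : Type*} [Group W] {M : CoxeterMatrix I} (cs : CoxeterSystem M W)

section Exchange

open scoped Classical in
/-- The action of a simple reflection on `W × ℤ/2` that conjugates the first entry and changes the
second one exactly when the first entry is that simple reflection. -/
def inversionFlip (i : I) : Function.End (W × ZMod 2) :=
  fun x => (cs.simple i * x.1 * (cs.simple i)⁻¹, x.2 + if x.1 = cs.simple i then 1 else 0)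

open scoped Classical in
/-- A word acts by conjugation and by counting the occurrences in its inversion sequence. -/
theorem prod_map_inversionFlip (ω : List I) (t : W) (e : ZMod 2) :
    (ω.map cs.inversionFlip).prod (t, e) =
      (cs.wordProd ω * t * (cs.wordProd ω)⁻¹, e + ((cs.rightInvSeq ω).count t : ZMod 2)) := by
  induction ω with
  | nil => simp; rfl
  | cons i ω ih =>
    rw [List.map_cons, List.prod_cons]
    change cs.inversionFlip i ((ω.map cs.inversionFlip).prod (t, e)) = _
    rw [ih]
    have hiff : cs.wordProd ω * t * (cs.wordProd ω)⁻¹ = cs.simple i ↔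
        (cs.wordProd ω)⁻¹ * cs.simple i * cs.wordProd ω = t := by
      constructor
      · intro h; rw [← h]; group
      · intro h; rw [← h]; group
    simp only [mul_assoc] at hiff
    simp only [inversionFlip, rightInvSeq, cs.wordProd_cons, List.count_cons, beq_iff_eq, hiff,
      mul_inv_rev, mul_assoc, Nat.cast_add, add_assoc]
    congr 3
    split_ifs <;> simp

theorem prod_map_inversionFlip_alternatingWord (i j : I) (m : ℕ) :
    ((alternatingWord i j (2 * m)).map cs.inversionFlip).prod =
      (cs.inversionFlip i * cs.inversionFlip j) ^ m := by
  induction m with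
  | zero => simp [alternatingWord]
  | succ m ih =>
    rw [show 2 * (m + 1) = 2 * m + 1 + 1 by ring, alternatingWord_succ, alternatingWord_succ,
      pow_succ, ← ih]
    simp

/-- The inversion sequence of the word `s_i s_j s_i ⋯` of length `2 m(i,j)` runs twice through the
reflections of the dihedral group, since `(s_i s_j) ^ m(i,j) = 1`. -/
theorem leftInvSeq_alternatingWord_eq_append (i j : I) :
    ∃ l : List W, cs.leftInvSeq (alternatingWord j i (2 * M i j)) = l ++ l := by
  refine ⟨(cs.leftInvSeq (alternatingWord j i (2 * M i j))).take (M i j), ?_⟩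
  apply List.ext_getElem
  · simp; omega
  intro k h₁ h₂
  have hk : k < 2 * M i j := by simpa using h₁
  by_cases hkm : k < M i j
  · rw [List.getElem_append_left (by simp; omega)]
    simp
  · rw [List.getElem_append_right (by simp; omega)]
    simp only [List.getElem_take, List.length_take, length_leftInvSeq, length_alternatingWord]
    rw [cs.getElem_leftInvSeq_alternatingWord _ _ _ _ hk,
      cs.getElem_leftInvSeq_alternatingWord _ _ _ _ (by omega),
      prod_alternatingWord_eq_mul_pow, prod_alternatingWord_eq_mul_pow]
    have h1 : ∀ n : ℕ, (2 * n + 1) / 2 = n := fun n => by omega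
    rw [h1, h1, if_neg (by simp), if_neg (by simp), min_eq_left (by omega)]
    conv_lhs => rw [show k = M i j + (k - M i j) by omega, pow_add, cs.simple_mul_simple_pow,
      one_mul]

theorem isLiftable_inversionFlip : M.IsLiftable cs.inversionFlip := by
  classical
  intro i j
  rw [← prod_map_inversionFlip_alternatingWord]
  funext x
  obtain ⟨t, e⟩ := x
  rw [prod_map_inversionFlip]
  have hrev : alternatingWord i j (2 * M i j) = (alternatingWord j i (2 * M i j)).reverse := by
    apply List.ext_getElem
    · simp
    intro k h₁ h₂
    have hk : k < 2 * M i j := by simpa using h₁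
    rw [List.getElem_reverse, getElem_alternatingWord _ _ _ _ hk,
      getElem_alternatingWord _ _ _ _ (by simp; omega)]
    simp only [length_alternatingWord]
    have : Even (2 * M i j + (2 * M i j - 1 - k)) ↔ ¬ Even (2 * M i j + k) := by
      rw [Nat.even_iff, Nat.even_iff]; omega
    simp only [this]
    split_ifs <;> rfl
  have hprod : cs.wordProd (alternatingWord i j (2 * M i j)) = 1 := by
    rw [prod_alternatingWord_eq_mul_pow]
    simp
  obtain ⟨l, hl⟩ := cs.leftInvSeq_alternatingWord_eq_append i j
  rw [hprod]
  rw [hrev, rightInvSeq_reverse, List.count_reverse, hl, List.count_append, Nat.cast_add,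
    CharTwo.add_self_eq_zero]
  simp
  rfl

open scoped Classical in
/-- The parity of the number of occurrences of `t` in the inversion sequence of a word depends only
on the element of `W` that the word represents. -/
theorem count_rightInvSeq_eq {ω ω' : List I} (h : cs.wordProd ω = cs.wordProd ω') (t : W) :
    ((cs.rightInvSeq ω).count t : ZMod 2) = (cs.rightInvSeq ω').count t := by
  have key : ∀ ω : List I, cs.lift ⟨cs.inversionFlip, cs.isLiftable_inversionFlip⟩
      (cs.wordProd ω) = (ω.map cs.inversionFlip).prod := by
    intro ω
    rw [wordProd, map_list_prod, List.map_map]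
    congr 1
    refine List.map_congr_left fun i _ => ?_
    exact cs.lift_apply_simple cs.isLiftable_inversionFlip i
  have h1 := congrFun ((key ω).symm.trans ((congrArg _ h).trans (key ω'))) (t, 0)
  rw [prod_map_inversionFlip, prod_map_inversionFlip] at h1
  simpa using congrArg Prod.snd h1

/-- The exchange condition: in a reduced word that ends in `s_i` and represents the same element,
`s_i` occurs exactly once in the inversion sequence, so it occurs in that of `ω`, too, and the
position where it does is the letter to erase. -/
theorem exists_eraseIdx_of_isRightDescent {ω : List I} {i : I}
    (h : cs.IsRightDescent (cs.wordProd ω) i) :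
    ∃ n < ω.length, cs.wordProd ω * cs.simple i = cs.wordProd (ω.eraseIdx n) := by
  classical
  obtain ⟨ω', hω', hw⟩ := cs.exists_isReduced (cs.wordProd ω * cs.simple i)
  have hprod : cs.wordProd (ω'.concat i) = cs.wordProd ω := by
    rw [wordProd_concat, ← hw, simple_mul_simple_cancel_right]
  have hred : cs.IsReduced (ω'.concat i) := by
    have h1 := (cs.isRightDescent_iff).1 h
    have h2 := hω'.eq
    rw [← hw] at h2
    rw [IsReduced, hprod, List.length_concat, ← h2, h1]
  have hcount := cs.count_rightInvSeq_eq hprod (cs.simple i)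
  rw [List.count_eq_one_of_mem hred.nodup_rightInvSeq
    (by rw [rightInvSeq_concat]; simp)] at hcount
  have hmem : cs.simple i ∈ cs.rightInvSeq ω := by
    by_contra hne
    rw [List.count_eq_zero_of_not_mem hne] at hcount
    simp at hcount
  obtain ⟨n, hn, hn'⟩ := List.mem_iff_getElem.1 hmem
  refine ⟨n, by simpa using hn, ?_⟩
  rw [← wordProd_mul_getD_rightInvSeq, List.getD_eq_getElem _ _ hn, hn']

end Exchange

section MinimalCosetRepresentatives

variable {cs}

theorem simple_mem_parabolic {J : Finset I} {j : I} (hj : j ∈ J) :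
    cs.simple j ∈ cs.parabolic J :=
  Subgroup.subset_closure ⟨j, by exact_mod_cast hj, rfl⟩

theorem wordProd_mem_parabolic {J : Finset I} {ω : List I} (h : ∀ j ∈ ω, j ∈ J) :
    cs.wordProd ω ∈ cs.parabolic J := by
  induction ω with
  | nil => simp
  | cons i ω ih =>
    rw [wordProd_cons]
    exact mul_mem (simple_mem_parabolic (h i (by simp))) (ih fun j hj => h j (by simp [hj]))

theorem exists_word_of_mem_parabolic {J : Finset I} {u : W} (hu : u ∈ cs.parabolic J) :
    ∃ ω : List I, (∀ j ∈ ω, j ∈ J) ∧ cs.wordProd ω = u := by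
  induction hu using Subgroup.closure_induction with
  | mem t ht =>
    obtain ⟨j, hj, rfl⟩ := ht
    exact ⟨[j], by simpa using hj, by simp⟩
  | one => exact ⟨[], by simp, by simp⟩
  | mul x y _ _ hx hy =>
    obtain ⟨ω, h, rfl⟩ := hx
    obtain ⟨ω', h', rfl⟩ := hy
    refine ⟨ω ++ ω', fun j hj => ?_, cs.wordProd_append _ _⟩
    rcases List.mem_append.1 hj with hj | hj
    exacts [h j hj, h' j hj]
  | inv x _ hx =>
    obtain ⟨ω, h, rfl⟩ := hx
    exact ⟨ω.reverse, fun j hj => h j (List.mem_reverse.1 hj), cs.wordProd_reverse ω⟩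

/-- If `x` has minimal length in `x W_J`, then every word in `J` can be shortened to a word in `J`
or adds its full length to that of `x`. -/
theorem length_mul_wordProd_of_minimal {J : Finset I} {x : W}
    (hx : ∀ u ∈ cs.parabolic J, cs.length x ≤ cs.length (x * u)) (ω : List I)
    (hω : ∀ j ∈ ω, j ∈ J) :
    cs.length (x * cs.wordProd ω) = cs.length x + ω.length ∨
      ∃ ω' : List I, (∀ j ∈ ω', j ∈ J) ∧ cs.wordProd ω' = cs.wordProd ω ∧
        ω'.length < ω.length := by
  induction ω using List.reverseRecOn with
  | nil => simp
  | append_singleton ω j ih =>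
    have hωJ : ∀ i ∈ ω, i ∈ J := fun i hi => hω i (by simp [hi])
    have hj : j ∈ J := hω j (by simp)
    rcases ih hωJ with h | ⟨ω', h1, h2, h3⟩
    · obtain ⟨ρ, hρ, rfl⟩ := cs.exists_isReduced x
      rcases cs.length_mul_simple (cs.wordProd ρ * cs.wordProd ω) j with hlen | hlen
      · left
        rw [cs.wordProd_append, wordProd_singleton, ← mul_assoc, hlen, h]
        simp [add_assoc]
      · right
        have hdesc : cs.IsRightDescent (cs.wordProd (ρ ++ ω)) j := by
          rw [IsRightDescent, cs.wordProd_append]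
          omega
        obtain ⟨n, hn, he⟩ := cs.exists_eraseIdx_of_isRightDescent hdesc
        rw [List.length_append] at hn
        by_cases hnρ : n < ρ.length
        · -- Erasing a letter of `ρ` would give an element of the coset shorter than `x`.
          exfalso
          rw [List.eraseIdx_append_of_lt_length hnρ, cs.wordProd_append, cs.wordProd_append,
            mul_assoc] at he
          have hu : cs.wordProd ω * cs.simple j * (cs.wordProd ω)⁻¹ ∈ cs.parabolic J :=
            mul_mem (mul_mem (wordProd_mem_parabolic hωJ) (simple_mem_parabolic hj))
              (inv_mem (wordProd_mem_parabolic hωJ))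
          have h4 := hx _ hu
          rw [← mul_assoc, he, mul_inv_cancel_right, hρ.eq] at h4
          have h5 := cs.length_wordProd_le (ρ.eraseIdx n)
          rw [List.length_eraseIdx_of_lt hnρ] at h5
          omega
        · rw [List.eraseIdx_append_of_length_le (by omega), cs.wordProd_append, cs.wordProd_append,
            mul_assoc] at he
          refine ⟨ω.eraseIdx (n - ρ.length),
            fun i hi => hωJ i (List.mem_of_mem_eraseIdx hi), ?_, ?_⟩
          · rw [cs.wordProd_append, wordProd_singleton, mul_left_cancel he]
          · rw [List.length_eraseIdx_of_lt (by omega)]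
            simp
    · right
      refine ⟨ω' ++ [j], ?_, ?_, by simpa using h3⟩
      · intro i hi
        rcases List.mem_append.1 hi with hi | hi
        · exact h1 i hi
        · rw [List.mem_singleton.1 hi]; exact hj
      · rw [cs.wordProd_append, cs.wordProd_append, h2]

/-- An element without right descents in `J` is strictly shorter than every other element of its
coset modulo `W_J`. -/
theorem length_lt_length_mul_of_not_isRightDescent {J : Finset I} {w : W}
    (hw : ∀ j ∈ J, ¬ cs.IsRightDescent w j) {u : W} (hu : u ∈ cs.parabolic J) (hu1 : u ≠ 1) :
    cs.length w < cs.length (w * u) := by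
  classical
  -- A word in `J` of least length for `u`, and the fact that it adds its length.
  have short : ∀ {x : W}, (∀ u ∈ cs.parabolic J, cs.length x ≤ cs.length (x * u)) →
      ∀ u ∈ cs.parabolic J, ∃ ω : List I, (∀ j ∈ ω, j ∈ J) ∧ cs.wordProd ω = u ∧
        (∀ ω' : List I, (∀ j ∈ ω', j ∈ J) → cs.wordProd ω' = u → ω.length ≤ ω'.length) ∧
        cs.length (x * u) = cs.length x + ω.length := by
    intro x hx u hu
    have hex : ∃ n, ∃ ω : List I, (∀ j ∈ ω, j ∈ J) ∧ cs.wordProd ω = u ∧ ω.length = n := by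
      obtain ⟨ω, h1, h2⟩ := exists_word_of_mem_parabolic hu
      exact ⟨_, ω, h1, h2, rfl⟩
    obtain ⟨ω, h1, h2, h3⟩ := Nat.find_spec hex
    have hmin : ∀ ω' : List I, (∀ j ∈ ω', j ∈ J) → cs.wordProd ω' = u →
        ω.length ≤ ω'.length := fun ω' h1' h2' => by
      rw [h3]; exact Nat.find_min' hex ⟨ω', h1', h2', rfl⟩
    refine ⟨ω, h1, h2, hmin, ?_⟩
    rcases length_mul_wordProd_of_minimal hx ω h1 with h | ⟨ω', h1', h2', h3'⟩
    · rwa [h2] at h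
    · have := hmin ω' h1' (h2'.trans h2)
      omega
  have hex : ∃ n, ∃ v ∈ cs.parabolic J, cs.length (w * v) = n := ⟨_, 1, one_mem _, rfl⟩
  obtain ⟨v, hv, hvn⟩ := Nat.find_spec hex
  have hx : ∀ u ∈ cs.parabolic J, cs.length (w * v) ≤ cs.length (w * v * u) := by
    intro u hu
    rw [hvn]
    exact Nat.find_min' hex ⟨v * u, mul_mem hv hu, by rw [mul_assoc]⟩
  obtain ⟨ω, h1, h2, h3, h4⟩ := short hx v⁻¹ (inv_mem hv)
  have hnil : ω = [] := by
    by_contra hne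
    obtain ⟨ω₀, j, rfl⟩ := List.eq_nil_or_concat' ω |>.resolve_left hne
    have hω₀ : ∀ i ∈ ω₀, i ∈ J := fun i hi => h1 i (by simp [hi])
    have hj : j ∈ J := h1 j (by simp)
    refine hw j hj ?_
    have hw' : w * cs.simple j = w * v * cs.wordProd ω₀ := by
      rw [cs.wordProd_append, wordProd_singleton] at h2
      have : cs.wordProd ω₀ = v⁻¹ * cs.simple j := by
        rw [← h2, simple_mul_simple_cancel_right]
      rw [this]; group
    rw [mul_inv_cancel_right, List.length_append, List.length_singleton] at h4
    rw [IsRightDescent, hw']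
    have h5 := cs.length_mul_le (w * v) (cs.wordProd ω₀)
    have h6 := cs.length_wordProd_le ω₀
    omega
  have hv1 : v = 1 := by
    rw [hnil, wordProd_nil] at h2
    rw [← inv_inv v, ← h2, inv_one]
  rw [hv1, mul_one] at hx
  obtain ⟨ω, h1, h2, h3, h4⟩ := short hx u hu
  rw [h4]
  have : ω ≠ [] := by
    rintro rfl
    exact hu1 (by rw [← h2, wordProd_nil])
  have := List.length_pos_of_ne_nil this
  omega

end MinimalCosetRepresentatives

end CoxeterSystem

/-! ### Signed sums over finite subsets -/

section SignedSums

variable {I : Type*} [LinearOrder I] (k : Type*) [Field k] {V : Type*} [AddCommGroup V] [Module k V]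

/-- The sign `(-1)^{i-1}`, where `i - 1` is the number of elements of `α` below `β`. -/
def boundarySign (α : Finset I) (β : I) : k := (-1) ^ (α.filter (· < β)).card

/-- The coboundary `(δa)(α) = ∑_i (-1)^{i-1} a(α ∖ α_i)` of a function on the finite subsets
`α = {α_1 < ⋯ < α_p}` of `I`. -/
def coboundary : (Finset I → V) →ₗ[k] (Finset I → V) where
  toFun a α := ∑ β ∈ α, boundarySign k α β • a (α.erase β)
  map_add' a b := by
    funext α
    simp [Finset.sum_add_distrib]
  map_smul' c a := by
    funext α
    simp only [Pi.smul_apply, RingHom.id_apply, Finset.smul_sum, smul_comm c]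

theorem coboundary_apply (a : Finset I → V) (α : Finset I) :
    coboundary k a α = ∑ β ∈ α, boundarySign k α β • a (α.erase β) := rfl

variable {k}

theorem boundarySign_mul_self (α : Finset I) (β : I) :
    boundarySign k α β * boundarySign k α β = 1 := by
  rw [boundarySign, ← mul_pow]; simp

theorem boundarySign_erase_of_le {α : Finset I} {β γ : I} (h : γ ≤ β) :
    boundarySign k (α.erase β) γ = boundarySign k α γ := by
  rw [boundarySign, boundarySign]
  congr 2
  ext x
  simp only [Finset.mem_filter, Finset.mem_erase]
  constructor
  · rintro ⟨⟨_, h1⟩, h2⟩; exact ⟨h1, h2⟩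
  · rintro ⟨h1, h2⟩; exact ⟨⟨(h2.trans_le h).ne, h1⟩, h2⟩

theorem boundarySign_erase_of_lt {α : Finset I} {β γ : I} (hβ : β ∈ α) (h : β < γ) :
    boundarySign k (α.erase β) γ = -boundarySign k α γ := by
  rw [boundarySign, boundarySign, Finset.filter_erase]
  have hmem : β ∈ α.filter (· < γ) := Finset.mem_filter.2 ⟨hβ, h⟩
  rw [← Finset.card_erase_add_one hmem, pow_succ]
  ring

theorem boundarySign_mul_erase {α : Finset I} {β γ : I} (hβ : β ∈ α) (hγ : γ ∈ α) (h : β ≠ γ) :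
    boundarySign k α β * boundarySign k (α.erase β) γ =
      -(boundarySign k α γ * boundarySign k (α.erase γ) β) := by
  rcases lt_or_gt_of_ne h with h | h
  · rw [boundarySign_erase_of_lt hβ h, boundarySign_erase_of_le h.le]; ring
  · rw [boundarySign_erase_of_le h.le, boundarySign_erase_of_lt hγ h]; ring

/-- An alternating sum over ordered pairs of elements of `α` vanishes if its terms do not depend on
the order of the pair. -/
theorem sum_boundarySign_smul_eq_zero (α : Finset I) (E : I → I → V)
    (hE : ∀ β ∈ α, ∀ γ ∈ α, β ≠ γ → E β γ = E γ β) :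
    ∑ β ∈ α, boundarySign k α β • ∑ γ ∈ α.erase β, boundarySign k (α.erase β) γ • E β γ = 0 := by
  simp_rw [Finset.smul_sum, smul_smul]
  rw [Finset.sum_sigma']
  refine Finset.sum_involution (fun x _ => ⟨x.2, x.1⟩) ?_ ?_ ?_ ?_
  · rintro ⟨β, γ⟩ h
    simp only [Finset.mem_sigma, Finset.mem_erase] at h
    dsimp only
    rw [boundarySign_mul_erase h.1 h.2.2 (Ne.symm h.2.1), hE β h.1 γ h.2.2 (Ne.symm h.2.1),
      neg_smul, neg_add_cancel]
  · rintro ⟨β, γ⟩ h _ he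
    simp only [Finset.mem_sigma, Finset.mem_erase] at h
    exact h.2.1 (congrArg Sigma.fst he)
  · rintro ⟨β, γ⟩ h
    simp only [Finset.mem_sigma, Finset.mem_erase] at h ⊢
    exact ⟨h.2.2, Ne.symm h.2.1, h.1⟩
  · rintro ⟨β, γ⟩ h
    rfl

theorem coboundary_map {V' : Type*} [AddCommGroup V'] [Module k V'] (f : V →ₗ[k] V')
    (a : Finset I → V) (α : Finset I) :
    coboundary k (fun γ => f (a γ)) α = f (coboundary k a α) := by
  simp [coboundary_apply]

theorem coboundary_apply_apply {X : Type*} (a : Finset I → X → V) (α : Finset I) (x : X) :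
    coboundary k a α x = coboundary k (fun γ => a γ x) α := by
  simp [coboundary_apply]

theorem coboundary_coboundary (a : Finset I → V) : coboundary k (coboundary k a) = 0 := by
  funext α
  simp only [coboundary_apply]
  exact sum_boundarySign_smul_eq_zero α (fun β γ => a ((α.erase β).erase γ))
    fun β _ γ _ _ => by rw [Finset.erase_right_comm]

variable (k)

/-- The contraction of the complex of all functions on finite subsets that adds the vertex `i`. -/
def boundaryHomotopy (i : I) (a : Finset I → V) (γ : Finset I) : V :=
  if i ∈ γ then 0 else boundarySign k γ i • a (insert i γ)

variable {k}

theorem boundarySign_insert_self (α : Finset I) (i : I) :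
    boundarySign k (insert i α) i = boundarySign k α i := by
  rw [boundarySign, boundarySign, Finset.filter_insert, if_neg (lt_irrefl i)]

theorem coboundary_boundaryHomotopy_add (i : I) (a : Finset I → V) (α : Finset I) :
    coboundary k (boundaryHomotopy k i a) α + boundaryHomotopy k i (coboundary k a) α = a α := by
  by_cases hi : i ∈ α
  · rw [boundaryHomotopy, if_pos hi, add_zero, coboundary_apply, Finset.sum_eq_single i]
    · rw [boundaryHomotopy, if_neg (Finset.notMem_erase i α), Finset.insert_erase hi, smul_smul,
        boundarySign_erase_of_le le_rfl, boundarySign_mul_self, one_smul]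
    · intro β _ hne
      rw [boundaryHomotopy, if_pos (Finset.mem_erase.2 ⟨hne.symm, hi⟩), smul_zero]
    · exact fun h => absurd hi h
  · rw [boundaryHomotopy, if_neg hi, coboundary_apply, coboundary_apply, Finset.sum_insert hi,
      boundarySign_insert_self, Finset.erase_insert hi, smul_add, smul_smul, boundarySign_mul_self,
      one_smul, add_left_comm, Finset.smul_sum, ← Finset.sum_add_distrib, Finset.sum_eq_zero,
      add_zero]
    intro β hβ
    have hne : β ≠ i := fun h => hi (h ▸ hβ)
    have h1 : i ∉ α.erase β := fun h => hi (Finset.mem_of_mem_erase h)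
    have h2 : boundarySign k (α.erase β) i = boundarySign k ((insert i α).erase β) i := by
      rw [Finset.erase_insert_of_ne hne.symm, boundarySign_insert_self]
    have h3 : boundarySign k α β = boundarySign k ((insert i α).erase i) β := by
      rw [Finset.erase_insert hi]
    have h4 : boundarySign k α i = boundarySign k (insert i α) i :=
      (boundarySign_insert_self α i).symm
    rw [boundaryHomotopy, if_neg h1, smul_smul, smul_smul, ← Finset.erase_insert_of_ne hne.symm,
      h2, h3, h4, mul_comm, ← add_smul]
    have h5 := boundarySign_mul_erase (k := k) (Finset.mem_insert_of_mem hβ)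
      (Finset.mem_insert_self i α) hne
    have h6 : boundarySign k ((insert i α).erase β) i * boundarySign k ((insert i α).erase i) β +
        boundarySign k (insert i α) i * boundarySign k (insert i α) β = 0 := by
      have hs := boundarySign_mul_self (k := k) (insert i α) β
      have hs' := boundarySign_mul_self (k := k) ((insert i α).erase i) β
      linear_combination
        boundarySign k (insert i α) β * boundarySign k ((insert i α).erase i) β * h5
        - boundarySign k ((insert i α).erase β) i * boundarySign k ((insert i α).erase i) β * hs
        - boundarySign k (insert i α) i * boundarySign k (insert i α) β * hs'
    rw [h6, zero_smul]

end SignedSums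

/-! ### The Coxeter complex -/

namespace CoxeterSystem
open CoxeterDynkin

variable {I : Type*} {W : Type*} [Group W] {M : CoxeterMatrix I} (cs : CoxeterSystem M W)
variable (k : Type*) [Field k]

section FreeModule

variable {V : Type*} [AddCommGroup V] [Module k V] [LinearOrder I]

/-- The functions `a α : W → V` form a cochain of the Coxeter complex of `B` with coefficients in
the functions from `W` to `V`: for `α ⊆ B` the function `a α` is constant on the cosets
`w W_{B ∖ α}`. -/
def IsCosetCochain (B : Finset I) (a : Finset I → W → V) : Prop :=
  ∀ α ⊆ B, ∀ u ∈ cs.parabolic (B \ α), ∀ w, a α (w * u) = a α w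

variable {cs k}

theorem IsCosetCochain.map_coboundary {B : Finset I} {a : Finset I → W → V}
    (ha : cs.IsCosetCochain B a) : cs.IsCosetCochain B (coboundary k a) := by
  intro α hα u hu w
  simp only [coboundary_apply, Finset.sum_apply, Pi.smul_apply]
  refine Finset.sum_congr rfl fun β _ => ?_
  rw [ha _ ((Finset.erase_subset _ _).trans hα) u
    (cs.parabolic_mono (Finset.sdiff_subset_sdiff subset_rfl (Finset.erase_subset _ _)) hu)]

/-- A cochain that vanishes on the elements shorter than `w` can only be non-zero at `(α, w)` if
`w` has no right descents in `B ∖ α`. -/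
theorem IsCosetCochain.not_isRightDescent {B : Finset I} {a : Finset I → W → V}
    (ha : cs.IsCosetCochain B a) {w : W}
    (hN : ∀ α ⊆ B, ∀ v, cs.length v < cs.length w → a α v = 0) {α : Finset I} (hα : α ⊆ B)
    (h : a α w ≠ 0) : ∀ j ∈ B \ α, ¬ cs.IsRightDescent w j := by
  intro j hj hd
  exact h (by rw [← ha α hα _ (simple_mem_parabolic hj) w]; exact hN α hα _ hd)

open scoped Classical in
variable (cs k) in
/-- The contraction of the part of a cochain that lives at `w`: it adds a vertex of `B` that is not
a right descent of `w`, and is zero if there is none. -/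
def descentHomotopy (B : Finset I) (a : Finset I → W → V) (w : W) (γ : Finset I) : V :=
  if h : ∃ i ∈ B, ¬ cs.IsRightDescent w i then
    boundaryHomotopy k h.choose (fun α => a α w) γ
  else 0

theorem IsCosetCochain.descentHomotopy_not_isRightDescent {B : Finset I} {a : Finset I → W → V}
    (ha : cs.IsCosetCochain B a) {w : W}
    (hN : ∀ α ⊆ B, ∀ v, cs.length v < cs.length w → a α v = 0) {γ : Finset I} (hγ : γ ⊆ B)
    (h : cs.descentHomotopy k B a w γ ≠ 0) : ∀ j ∈ B \ γ, ¬ cs.IsRightDescent w j := by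
  rw [descentHomotopy] at h
  split_ifs at h with hex
  · set i := hex.choose
    have hi : i ∈ B ∧ ¬ cs.IsRightDescent w i := hex.choose_spec
    rw [boundaryHomotopy] at h
    split_ifs at h with hiγ
    · exact absurd rfl h
    · have h1 : a (insert i γ) w ≠ 0 := fun h0 => h (by rw [h0, smul_zero])
      intro j hj
      by_cases hji : j = i
      · rw [hji]; exact hi.2
      · rw [Finset.mem_sdiff] at hj
        refine ha.not_isRightDescent hN (Finset.insert_subset hi.1 hγ) h1 j ?_
        simp [hj, hji]
  · exact absurd rfl h

theorem IsCosetCochain.coboundary_descentHomotopy {B : Finset I} {a : Finset I → W → V}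
    (ha : cs.IsCosetCochain B a) {w : W}
    (hN : ∀ α ⊆ B, ∀ v, cs.length v < cs.length w → a α v = 0)
    (hδ : ∀ α ⊆ B, coboundary k a α = 0) (htop : a B = 0) {α : Finset I} (hα : α ⊆ B) :
    coboundary k (cs.descentHomotopy k B a w) α = a α w := by
  by_cases hex : ∃ i ∈ B, ¬ cs.IsRightDescent w i
  · have hd : cs.descentHomotopy k B a w =
        boundaryHomotopy k hex.choose (fun α => a α w) := by
      funext γ
      rw [descentHomotopy, dif_pos hex]
    have hi := hex.choose_spec
    rw [hd, ← coboundary_boundaryHomotopy_add (k := k) hex.choose (fun α => a α w) α]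
    conv_lhs => rw [← add_zero (coboundary k _ α)]
    congr 1
    rw [boundaryHomotopy]
    split_ifs
    · rfl
    · rw [← coboundary_apply_apply, hδ _ (Finset.insert_subset hi.1 hα), Pi.zero_apply, smul_zero]
  · have hd : cs.descentHomotopy k B a w = 0 := by
      funext γ
      rw [descentHomotopy, dif_neg hex, Pi.zero_apply]
    rw [hd, map_zero, Pi.zero_apply]
    by_contra h
    rcases hα.eq_or_ssubset with rfl | hss
    · exact h (by rw [htop, Pi.zero_apply])
    · obtain ⟨j, hjB, hjα⟩ := Finset.exists_of_ssubset hss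
      exact hex ⟨j, hjB, ha.not_isRightDescent hN hα (Ne.symm h) j
        (Finset.mem_sdiff.2 ⟨hjB, hjα⟩)⟩

theorem descentHomotopy_erase {B : Finset I} {a : Finset I → W → V} (htop : a B = 0) (w : W)
    (β : I) : cs.descentHomotopy k B a w (B.erase β) = 0 := by
  rw [descentHomotopy]
  split_ifs with hex
  · have hi := hex.choose_spec
    rw [boundaryHomotopy]
    split_ifs with h
    · rfl
    · rw [Finset.mem_erase, not_and_or, not_not] at h
      rcases h with h | h
      · rw [h, Finset.insert_erase (h ▸ hi.1), htop, Pi.zero_apply, smul_zero]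
      · exact absurd hi.1 h
  · rfl

variable [Finite W]

/-- A cocycle of the Coxeter complex that vanishes in top degree and on all elements shorter than
`N` can be changed by a coboundary so as to vanish on the elements of length `N`, too. -/
theorem IsCosetCochain.exists_coboundary_step {B : Finset I} {a : Finset I → W → V}
    (ha : cs.IsCosetCochain B a) (hδ : ∀ α ⊆ B, coboundary k a α = 0) (htop : a B = 0)
    {N : ℕ} (hN : ∀ α ⊆ B, ∀ w, cs.length w < N → a α w = 0) :
    ∃ b : Finset I → W → V, cs.IsCosetCochain B b ∧ coboundary k b B = 0 ∧
      ∀ α ⊆ B, ∀ w, cs.length w < N + 1 → coboundary k b α w = a α w := by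
  classical
  have := Fintype.ofFinite W
  -- Spread the contraction at each `x` of length `N` over the coset `x W_{B ∖ γ}`.
  let b : Finset I → W → V := fun γ w => ∑ x : W,
    if cs.length x = N ∧ x⁻¹ * w ∈ cs.parabolic (B \ γ) then cs.descentHomotopy k B a x γ else 0
  have hb : ∀ γ ⊆ B, ∀ w, cs.length w < N + 1 →
      b γ w = if cs.length w = N then cs.descentHomotopy k B a w γ else 0 := by
    intro γ hγ w hw
    simp only [b]
    rw [Finset.sum_eq_single w]
    · simp
    · intro x _ hxw
      rw [ite_eq_right_iff]
      rintro ⟨hx, hmem⟩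
      by_contra hne
      have hlt := length_lt_length_mul_of_not_isRightDescent
        (ha.descentHomotopy_not_isRightDescent (hx ▸ hN) hγ hne) hmem
        (fun h => hxw (inv_mul_eq_one.1 h))
      rw [mul_inv_cancel_left] at hlt
      omega
    · exact fun h => absurd (Finset.mem_univ w) h
  refine ⟨b, ?_, ?_, ?_⟩
  · intro γ _ u hu w
    refine Finset.sum_congr rfl fun x _ => ?_
    rw [← mul_assoc, Subgroup.mul_mem_cancel_right _ hu]
  · rw [coboundary_apply]
    refine Finset.sum_eq_zero fun β _ => ?_
    have : b (B.erase β) = 0 := by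
      funext w
      simp only [b, descentHomotopy_erase htop, ite_self, Finset.sum_const_zero, Pi.zero_apply]
    rw [this, smul_zero]
  · intro α hα w hw
    have hbα : ∀ β ∈ α, b (α.erase β) w =
        if cs.length w = N then cs.descentHomotopy k B a w (α.erase β) else 0 := fun β _ =>
      hb _ ((Finset.erase_subset _ _).trans hα) w hw
    rw [coboundary_apply_apply, coboundary_apply, Finset.sum_congr rfl fun β hβ => by rw [hbα β hβ]]
    by_cases hwN : cs.length w = N
    · simp only [if_pos hwN]
      exact ha.coboundary_descentHomotopy (hwN ▸ hN) hδ htop hα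
    · simp only [if_neg hwN, smul_zero, Finset.sum_const_zero]
      exact (hN α hα w (by omega)).symm

/-- Exactness of the Coxeter complex below the top degree, for coefficients in the
functions from `W` to `V`. -/
theorem IsCosetCochain.exists_coboundary {B : Finset I} {a : Finset I → W → V}
    (ha : cs.IsCosetCochain B a) (hδ : ∀ α ⊆ B, coboundary k a α = 0) (htop : a B = 0) :
    ∃ b : Finset I → W → V, cs.IsCosetCochain B b ∧ ∀ α ⊆ B, coboundary k b α = a α := by
  have key : ∀ N : ℕ, ∃ b : Finset I → W → V, cs.IsCosetCochain B b ∧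
      coboundary k b B = 0 ∧
      ∀ α ⊆ B, ∀ w, cs.length w < N → coboundary k b α w = a α w := by
    intro N
    induction N with
    | zero =>
      refine ⟨0, fun _ _ _ _ _ => rfl, by rw [map_zero, Pi.zero_apply], ?_⟩
      exact fun α _ w h => absurd h (by omega)
    | succ N ih =>
      obtain ⟨b, hb, hbB, hbN⟩ := ih
      have hsub : cs.IsCosetCochain B (a - coboundary k b) := fun α hα u hu w => by
        simp only [Pi.sub_apply, ha α hα u hu w, hb.map_coboundary α hα u hu w]
      obtain ⟨b', hb', hbB', hbN'⟩ := hsub.exists_coboundary_step (k := k) (N := N)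
        (fun α hα => by
          rw [map_sub, coboundary_coboundary, sub_zero, hδ α hα])
        (by rw [Pi.sub_apply, htop, hbB, sub_zero])
        (fun α hα w hw => by
          rw [Pi.sub_apply, Pi.sub_apply, hbN α hα w hw, sub_self])
      refine ⟨b + b', fun α hα u hu w => ?_, ?_, fun α hα w hw => ?_⟩
      · simp only [Pi.add_apply, hb α hα u hu w, hb' α hα u hu w]
      · rw [map_add, Pi.add_apply, hbB, hbB', add_zero]
      · rw [map_add, Pi.add_apply, Pi.add_apply, hbN' α hα w hw, Pi.sub_apply, Pi.sub_apply,
          add_sub_cancel]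
  obtain ⟨n, hn⟩ := (Set.finite_range cs.length).bddAbove
  obtain ⟨b, hb, -, hbN⟩ := key (n + 1)
  exact ⟨b, hb, fun α hα => funext fun w => hbN α hα w (Nat.lt_succ_of_le (hn ⟨w, rfl⟩))⟩

end FreeModule

section Restriction

variable {k}

open scoped Classical in
/-- The projection of `k W` onto the group algebra of a subgroup that restricts the support. -/
def supportProjection (H : Subgroup W) : MonoidAlgebra k W →ₗ[k] MonoidAlgebra k W :=
  (MonoidAlgebra.coeffLinearEquiv k).symm.toLinearMap ∘ₗ
    (Finsupp.supported k k (H : Set W)).subtype ∘ₗ Finsupp.restrictDom k k (H : Set W) ∘ₗ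
      (MonoidAlgebra.coeffLinearEquiv k).toLinearMap

open scoped Classical in
theorem supportProjection_coeff (H : Subgroup W) (f : MonoidAlgebra k W) :
    (supportProjection H f).coeff = f.coeff.filter (· ∈ H) := rfl

theorem supportProjection_mem (H : Subgroup W) (f : MonoidAlgebra k W) :
    supportProjection H f ∈ MonoidAlgebra.supported k k (H : Set W) := by
  classical
  rw [MonoidAlgebra.mem_supported']
  intro g hg
  rw [supportProjection_coeff]
  exact Finsupp.filter_apply_neg _ _ hg

theorem supportProjection_of_mem {H : Subgroup W} {f : MonoidAlgebra k W}
    (hf : f ∈ MonoidAlgebra.supported k k (H : Set W)) : supportProjection H f = f := by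
  classical
  apply MonoidAlgebra.coeff_injective
  rw [supportProjection_coeff, Finsupp.filter_eq_self_iff]
  intro g hg
  by_contra h
  exact hg (MonoidAlgebra.mem_supported'.1 hf g h)

theorem supportProjection_conj {H : Subgroup W} {w : W} (hw : w ∈ H) (f : MonoidAlgebra k W) :
    supportProjection H (conj k w f) = conj k w (supportProjection H f) := by
  classical
  have hs : ∀ (g : W) (r : k), supportProjection H (MonoidAlgebra.single g r) =
      if g ∈ H then MonoidAlgebra.single g r else 0 := by
    intro g r
    apply MonoidAlgebra.coeff_injective
    rw [supportProjection_coeff]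
    split_ifs with h
    · exact Finsupp.filter_single_of_pos _ h
    · exact Finsupp.filter_single_of_neg _ h
  induction f using MonoidAlgebra.induction_linear with
  | zero => simp
  | add f g hf hg => rw [map_add, map_add, hf, hg, map_add, map_add]
  | single g r =>
    rw [conj_single, hs, hs]
    have : w * g * w⁻¹ ∈ H ↔ g ∈ H := by
      rw [Subgroup.mul_mem_cancel_right _ (inv_mem hw), Subgroup.mul_mem_cancel_left _ hw]
    simp only [this]
    split_ifs
    · rw [conj_single]
    · rw [map_zero]

end Restriction

section Invariants

variable {k}

/-- Modulo the sum of the fixed spaces of the simple reflections in `B`, the group `W_B` acts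
through the sign character. -/
theorem sub_sign_smul_conj_mem {B : Finset I} {w : W} (hw : w ∈ cs.parabolic B) :
    ∀ v ∈ cs.parabolicAlgebra k B, v - (((cs.sign w : ℤˣ) : ℤ) : k) • conj k w v ∈
      ⨆ β ∈ B, cs.fixedPart k B {β} := by
  obtain ⟨ω, hω, rfl⟩ := exists_word_of_mem_parabolic hw
  clear hw
  induction ω with
  | nil => intro v _; simp [conj_one]
  | cons i ω ih =>
    intro v hv
    have hi : i ∈ B := hω i (by simp)
    have hωB : ∀ j ∈ ω, j ∈ B := fun j hj => hω j (by simp [hj])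
    have h1 := ih hωB v hv
    set v' := (((cs.sign (cs.wordProd ω) : ℤˣ) : ℤ) : k) • conj k (cs.wordProd ω) v with hv'
    have hv'B : v' ∈ cs.parabolicAlgebra k B :=
      Submodule.smul_mem _ _ (conj_mem_supported (wordProd_mem_parabolic hωB) hv)
    have h2 : v' + conj k (cs.simple i) v' ∈ cs.fixedPart k B {i} := by
      refine ⟨add_mem hv'B (conj_mem_supported (simple_mem_parabolic hi) hv'B),
        conj_fixed_of_closure ?_⟩
      rintro _ ⟨j, hj, rfl⟩
      have hji : j = i := by simpa using hj
      rw [hji, map_add, ← CoxeterDynkin.conj_mul, cs.simple_mul_simple_self, conj_one, add_comm]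
    have h3 := add_mem h1 (Submodule.mem_iSup_of_mem i (Submodule.mem_iSup_of_mem hi h2))
    convert h3 using 1
    rw [cs.wordProd_cons, map_mul, sign_simple, CoxeterDynkin.conj_mul, hv', map_smul]
    simp only [neg_mul, one_mul, Units.val_neg, Int.cast_neg, neg_smul]
    abel

variable [Fintype W]

variable (k W) in
/-- The retraction `f ↦ |W|⁻¹ ∑_w w⁻¹ f(w) w` of the embedding `v ↦ (w ↦ w v w⁻¹)` of `k W` into
the functions on `W` with values in `k W`. -/
def averageRetraction : (W → MonoidAlgebra k W) →ₗ[k] MonoidAlgebra k W :=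
  (Fintype.card W : k)⁻¹ • ∑ w : W, conj k w⁻¹ ∘ₗ LinearMap.proj w

theorem averageRetraction_apply (f : W → MonoidAlgebra k W) :
    averageRetraction W k f = (Fintype.card W : k)⁻¹ • ∑ w : W, conj k w⁻¹ (f w) := by
  simp [averageRetraction]

theorem averageRetraction_conj [CharZero k] (v : MonoidAlgebra k W) :
    averageRetraction W k (fun w => conj k w v) = v := by
  rw [averageRetraction_apply]
  simp_rw [← CoxeterDynkin.conj_mul, inv_mul_cancel, conj_one]
  rw [Finset.sum_const, Finset.card_univ, ← Nat.cast_smul_eq_nsmul k, smul_smul,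
    inv_mul_cancel₀ (Nat.cast_ne_zero.2 Fintype.card_ne_zero), one_smul]

theorem conj_averageRetraction {f : W → MonoidAlgebra k W} {u : W}
    (h : ∀ w, f (w * u) = f w) :
    conj k u (averageRetraction W k f) = averageRetraction W k f := by
  rw [averageRetraction_apply, map_smul, map_sum]
  congr 1
  symm
  refine Fintype.sum_equiv (Equiv.mulRight u) _ _ fun w => ?_
  dsimp only [Equiv.coe_mulRight]
  rw [← CoxeterDynkin.conj_mul, h, mul_inv_rev, mul_inv_cancel_left]

/-- An element killed by antisymmetrisation is a sum of elements fixed by simple reflections. -/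
theorem mem_iSup_fixedPart_of_Alt_eq_zero [CharZero k] {B : Finset I} {v : MonoidAlgebra k W}
    (hv : v ∈ cs.parabolicAlgebra k B) (h : cs.Alt k B v = 0) :
    v ∈ ⨆ β ∈ B, cs.fixedPart k B {β} := by
  classical
  have hcard : (Nat.card (cs.parabolic B) : k) ≠ 0 := Nat.cast_ne_zero.2 Nat.card_pos.ne'
  have hsum : ∑ w : cs.parabolic B, (((cs.sign (w : W) : ℤˣ) : ℤ) : k) • conj k (w : W) v = 0 := by
    simp only [Alt, LinearMap.smul_apply, LinearMap.sum_apply] at h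
    exact (smul_eq_zero.1 h).resolve_left (inv_ne_zero hcard)
  have hmem := Submodule.sum_mem (⨆ β ∈ B, cs.fixedPart k B {β})
    fun (w : cs.parabolic B) (_ : w ∈ Finset.univ) => sub_sign_smul_conj_mem cs w.2 v hv
  rw [Finset.sum_sub_distrib, hsum, sub_zero, Finset.sum_const, Finset.card_univ,
    ← Nat.card_eq_fintype_card, ← Nat.cast_smul_eq_nsmul k] at hmem
  exact (Submodule.smul_mem_iff _ hcard).1 hmem

variable [LinearOrder I] [CharZero k]

/-- Exactness of the Coxeter complex of `W_B` with coefficients in `k W_B` below the top degree. -/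
theorem exists_coboundary_of_top_eq_zero {B : Finset I} {a : Finset I → MonoidAlgebra k W}
    (ha : ∀ α ⊆ B, a α ∈ cs.fixedPart k B (B \ α)) (hδ : ∀ α ⊆ B, coboundary k a α = 0)
    (htop : a B = 0) :
    ∃ b : Finset I → MonoidAlgebra k W, (∀ γ ⊆ B, b γ ∈ cs.fixedPart k B (B \ γ)) ∧
      ∀ α ⊆ B, coboundary k b α = a α := by
  let ι : MonoidAlgebra k W →ₗ[k] (W → MonoidAlgebra k W) := LinearMap.pi fun w => conj k w
  have hι : cs.IsCosetCochain B (fun α => ι (a α)) := by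
    intro α hα u hu w
    change conj k (w * u) (a α) = conj k w (a α)
    rw [CoxeterDynkin.conj_mul, (ha α hα).2 u hu]
  obtain ⟨b, hb, hbδ⟩ := hι.exists_coboundary (k := k)
    (fun α hα => by rw [coboundary_map, hδ α hα, map_zero]) (by simp only [htop, map_zero])
  refine ⟨fun γ => supportProjection (cs.parabolic B) (averageRetraction W k (b γ)),
    fun γ hγ => ⟨supportProjection_mem _ _, fun u hu => ?_⟩, fun α hα => ?_⟩
  · rw [← supportProjection_conj (cs.parabolic_mono Finset.sdiff_subset hu),
      conj_averageRetraction (hb γ hγ u hu)]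
  · rw [coboundary_map, coboundary_map, hbδ α hα]
    change supportProjection _ (averageRetraction W k fun w => conj k w (a α)) = a α
    rw [averageRetraction_conj, supportProjection_of_mem (ha α hα).1]

/-- Cohomology of the Coxeter complex of `W_B` with coefficients in `k W_B`: a cocycle whose top
component is killed by antisymmetrisation is a coboundary. -/
theorem exists_coboundary_of_Alt_eq_zero {B : Finset I} {a : Finset I → MonoidAlgebra k W}
    (ha : ∀ α ⊆ B, a α ∈ cs.fixedPart k B (B \ α)) (hδ : ∀ α ⊆ B, coboundary k a α = 0)
    (htop : cs.Alt k B (a B) = 0) :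
    ∃ b : Finset I → MonoidAlgebra k W, (∀ γ ⊆ B, b γ ∈ cs.fixedPart k B (B \ γ)) ∧ b B = 0 ∧
      ∀ α ⊆ B, coboundary k b α = a α := by
  classical
  have hfix : ∀ β ∈ B, B \ B.erase β = {β} := fun β hβ => Finset.sdiff_erase_self hβ
  obtain ⟨c, hc⟩ := (Submodule.mem_iSup_finset_iff_exists_sum _ _).1
    (mem_iSup_fixedPart_of_Alt_eq_zero cs (ha B subset_rfl).1 htop)
  -- The top component is the coboundary of `b₀`, which lives in the degree below.
  let b₀ : Finset I → MonoidAlgebra k W := fun γ =>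
    ∑ β ∈ B, if γ = B.erase β then boundarySign k B β • (c β : MonoidAlgebra k W) else 0
  have hb₀ : ∀ γ, b₀ γ ∈ cs.fixedPart k B (B \ γ) := by
    intro γ
    refine Submodule.sum_mem _ fun β hβ => ?_
    split_ifs with h
    · rw [h, hfix β hβ]
      exact Submodule.smul_mem _ _ (c β).2
    · exact zero_mem _
  have hb₀B : coboundary k b₀ B = a B := by
    rw [coboundary_apply, ← hc]
    refine Finset.sum_congr rfl fun β hβ => ?_
    simp only [b₀]
    rw [Finset.sum_eq_single β]
    · rw [if_pos rfl, smul_smul, boundarySign_mul_self, one_smul]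
    · intro β' hβ' hne
      rw [if_neg]
      intro h
      exact hne (Finset.erase_injOn B hβ' hβ h.symm)
    · exact fun h => absurd hβ h
  have hcob : ∀ α ⊆ B, coboundary k b₀ α ∈ cs.fixedPart k B (B \ α) := by
    intro α _
    rw [coboundary_apply]
    refine Submodule.sum_mem _ fun β _ => Submodule.smul_mem _ _ ?_
    exact cs.fixedPart_mono k subset_rfl
      (Finset.sdiff_subset_sdiff subset_rfl (Finset.erase_subset _ _)) (hb₀ _)
  obtain ⟨b, hb, hbδ⟩ := exists_coboundary_of_top_eq_zero cs (a := a - coboundary k b₀)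
    (fun α hα => sub_mem (ha α hα) (hcob α hα))
    (fun α hα => by rw [map_sub, coboundary_coboundary, sub_zero, hδ α hα])
    (by rw [Pi.sub_apply, hb₀B, sub_self])
  refine ⟨fun γ => if γ = B then 0 else b₀ γ + b γ, fun γ hγ => ?_, if_pos rfl, fun α hα => ?_⟩
  · dsimp only
    split_ifs
    · exact zero_mem _
    · exact add_mem (hb₀ γ) (hb γ hγ)
  · have h1 : coboundary k (fun γ => if γ = B then 0 else b₀ γ + b γ) α =
        coboundary k (b₀ + b) α := by
      rw [coboundary_apply, coboundary_apply]
      refine Finset.sum_congr rfl fun β hβ => ?_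
      rw [if_neg, Pi.add_apply]
      intro h
      exact Finset.notMem_erase β α (h ▸ hα hβ)
    rw [h1, map_add, Pi.add_apply, hbδ α hα, Pi.sub_apply, add_sub_cancel]

end Invariants

end CoxeterSystem

/-! ### Connected components of subdiagrams -/

namespace CoxeterMatrix

variable {I : Type*} {M : CoxeterMatrix I}

/-- A connected subdiagram that meets a set closed under adjacency within it lies in that set. -/
theorem IsConnectedSubdiagram.subset_of_closed {A : Finset I} (hA : M.IsConnectedSubdiagram A)
    {S : Finset I} {a : I} (ha : a ∈ A) (haS : a ∈ S)
    (hS : ∀ i ∈ S, ∀ j ∈ A, M.coxeterGraph.Adj i j → j ∈ S) : A ⊆ S := by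
  intro j hj
  have h := (SimpleGraph.reachable_iff_reflTransGen _ _).1
    (hA.preconnected ⟨a, by exact_mod_cast ha⟩ ⟨j, by exact_mod_cast hj⟩)
  suffices key : ∀ x : (A : Set I), Relation.ReflTransGen (M.coxeterGraph.induce (A : Set I)).Adj
      ⟨a, by exact_mod_cast ha⟩ x → (x : I) ∈ S from key _ h
  intro x hx
  induction hx with
  | refl => exact haS
  | @tail y z _ hyz ih => exact hS _ ih z (by exact_mod_cast z.2) hyz

theorem IsConnectedSubdiagram.nonempty {A : Finset I} (hA : M.IsConnectedSubdiagram A) :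
    A.Nonempty := by
  obtain ⟨x⟩ := SimpleGraph.Connected.nonempty hA
  exact ⟨x, by exact_mod_cast x.2⟩

theorem isConnectedSubdiagram_singleton (i : I) : M.IsConnectedSubdiagram {i} := by
  rw [IsConnectedSubdiagram, Finset.coe_singleton]
  exact SimpleGraph.Connected.mk (SimpleGraph.Preconnected.of_subsingleton)

theorem IsConnectedSubdiagram.insert_of_adj [DecidableEq I] {A : Finset I}
    (hA : M.IsConnectedSubdiagram A) {i j : I} (hi : i ∈ A) (h : M.coxeterGraph.Adj i j) :
    M.IsConnectedSubdiagram (insert j A) := by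
  have h1 := SimpleGraph.induce_union_connected (SimpleGraph.Connected.preconnected hA)
    (SimpleGraph.induce_pair_connected_of_adj h).preconnected
    ⟨i, Finset.mem_coe.2 hi, Set.mem_insert _ _⟩
  have h2 : ((insert j A : Finset I) : Set I) = (A : Set I) ∪ {i, j} := by
    ext x
    simp only [Finset.coe_insert, Set.mem_insert_iff, Finset.mem_coe, Set.mem_union,
      Set.mem_singleton_iff]
    constructor
    · rintro (h | h)
      exacts [Or.inr (Or.inr h), Or.inl h]
    · rintro (h | h | h)
      exacts [Or.inr h, Or.inr (h ▸ hi), Or.inl h]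
  rw [IsConnectedSubdiagram, h2]
  exact h1

theorem IsConnectedSubdiagram.subset_component {A C X : Finset I}
    (hA : M.IsConnectedSubdiagram A) (hAX : A ⊆ X) (hC : M.IsComponent C X) {i : I} (hiA : i ∈ A)
    (hiC : i ∈ C) : A ⊆ C := by
  refine hA.subset_of_closed hiA hiC fun x hx y hy hxy => ?_
  by_contra hyC
  exact hC.2.2 x hx y (hAX hy) hyC hxy

theorem IsComponent.eq_of_mem {C C' X : Finset I} (hC : M.IsComponent C X)
    (hC' : M.IsComponent C' X) {i : I} (hi : i ∈ C) (hi' : i ∈ C') : C = C' :=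
  (hC.2.1.subset_component hC.1 hC' hi hi').antisymm (hC'.2.1.subset_component hC'.1 hC hi' hi)

theorem exists_isComponent_mem {X : Finset I} {i : I} (hi : i ∈ X) :
    ∃ C, M.IsComponent C X ∧ i ∈ C := by
  classical
  have hne : (X.powerset.filter fun A => M.IsConnectedSubdiagram A ∧ i ∈ A).Nonempty :=
    ⟨{i}, by simpa [hi] using isConnectedSubdiagram_singleton i⟩
  obtain ⟨C, hC, hmax⟩ := Finset.exists_max_image _ Finset.card hne
  simp only [Finset.mem_filter, Finset.mem_powerset] at hC hmax
  refine ⟨C, ⟨hC.1, hC.2.1, fun x hx y hy hyC hxy => ?_⟩, hC.2.2⟩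
  have := hmax (insert y C) ⟨Finset.insert_subset hy hC.1, hC.2.1.insert_of_adj hx hxy,
    Finset.mem_insert_of_mem hC.2.2⟩
  rw [Finset.card_insert_of_notMem hyC] at this
  omega

variable (M) in
open scoped Classical in
/-- The connected components of the full subgraph with vertex set `X`. -/
def components (X : Finset I) : Finset (Finset I) := X.powerset.filter fun C => M.IsComponent C X

theorem mem_components {C X : Finset I} : C ∈ M.components X ↔ M.IsComponent C X := by
  simp only [components, Finset.mem_filter, Finset.mem_powerset, and_iff_right_iff_imp]
  exact fun h => h.1

/-- The components of `Y ∖ γ` are the components of `Y` that do not contain `γ` and the components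
of `C ∖ γ`, where `C` is the component of `Y` that contains `γ`. -/
theorem sum_components_erase [DecidableEq I] {V : Type*} [AddCommMonoid V] {Y : Finset I} {γ : I}
    (hγ : γ ∈ Y) (g : Finset I → V) :
    ∑ C ∈ M.components (Y.erase γ), g C =
      ∑ C ∈ M.components Y, if γ ∈ C then ∑ C' ∈ M.components (C.erase γ), g C' else g C := by
  classical
  obtain ⟨C₀, hC₀, hγC₀⟩ := M.exists_isComponent_mem hγ
  have hmem : C₀ ∈ M.components Y := mem_components.2 hC₀
  have huniq : ∀ C ∈ (M.components Y).erase C₀, γ ∉ C := by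
    intro C hC hγC
    rw [Finset.mem_erase, mem_components] at hC
    exact hC.1 (hC.2.eq_of_mem hC₀ hγC hγC₀)
  rw [← Finset.add_sum_erase _ _ hmem, if_pos hγC₀,
    Finset.sum_congr rfl fun C hC => if_neg (huniq C hC), ← Finset.sum_union]
  · refine Finset.sum_congr ?_ fun _ _ => rfl
    ext C
    simp only [Finset.mem_union, Finset.mem_erase, mem_components]
    constructor
    · intro hC
      by_cases hmeet : ∃ i ∈ C, i ∈ C₀
      · left
        obtain ⟨i, hi, hi₀⟩ := hmeet
        have hsub := hC.2.1.subset_component (hC.1.trans (Finset.erase_subset _ _)) hC₀ hi hi₀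
        refine ⟨fun x hx => Finset.mem_erase.2 ⟨(Finset.mem_erase.1 (hC.1 hx)).1, hsub hx⟩,
          hC.2.1, fun x hx y hy hyC => hC.2.2 x hx y (Finset.erase_subset_erase _ hC₀.1 hy) hyC⟩
      · right
        push Not at hmeet
        refine ⟨?_, hC.1.trans (Finset.erase_subset _ _), hC.2.1, fun x hx y hy hyC hxy => ?_⟩
        · rintro rfl
          obtain ⟨x, hx⟩ := hC.2.1.nonempty
          exact hmeet x hx hx
        · by_cases hyγ : y = γ
          · subst hyγ
            exact hC₀.2.2 y hγC₀ x (Finset.mem_of_mem_erase (hC.1 hx)) (hmeet x hx) hxy.symm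
          · exact hC.2.2 x hx y (Finset.mem_erase.2 ⟨hyγ, hy⟩) hyC hxy
    · rintro (hC | ⟨hne, hC⟩)
      · refine ⟨hC.1.trans (Finset.erase_subset_erase _ hC₀.1), hC.2.1,
          fun x hx y hy hyC hxy => ?_⟩
        rw [Finset.mem_erase] at hy
        by_cases hy₀ : y ∈ C₀
        · exact hC.2.2 x hx y (Finset.mem_erase.2 ⟨hy.1, hy₀⟩) hyC hxy
        · exact hC₀.2.2 x (Finset.mem_of_mem_erase (hC.1 hx)) y hy.2 hy₀ hxy
      · have hγC : γ ∉ C := huniq C (Finset.mem_erase.2 ⟨hne, mem_components.2 hC⟩)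
        refine ⟨fun x hx => Finset.mem_erase.2 ⟨?_, hC.1 hx⟩, hC.2.1,
          fun x hx y hy hyC => hC.2.2 x hx y (Finset.mem_of_mem_erase hy) hyC⟩
        rintro rfl
        exact hγC hx
  · rw [Finset.disjoint_left]
    intro C hC hC'
    rw [Finset.mem_erase, mem_components] at hC'
    rw [mem_components] at hC
    obtain ⟨x, hx⟩ := hC.2.1.nonempty
    exact hC'.1 (hC'.2.eq_of_mem hC₀ hx (Finset.mem_of_mem_erase (hC.1 hx)))

end CoxeterMatrix

/-! ### The two complexes and the comparison map -/

namespace CoxeterSystem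
open CoxeterDynkin

variable {I : Type*} {W : Type*} [Group W] {M : CoxeterMatrix I} {cs : CoxeterSystem M W}
variable {k : Type*} [Field k]

section Antisymmetrisation

theorem sign_mul_sign (w : W) :
    (((cs.sign w : ℤˣ) : ℤ) : k) * (((cs.sign w : ℤˣ) : ℤ) : k) = 1 := by
  rw [← Int.cast_mul, ← Units.val_mul, Int.units_mul_self, Units.val_one, Int.cast_one]

variable [Fintype W]

theorem Alt_apply (B : Finset I) (f : MonoidAlgebra k W) [Fintype (cs.parabolic B)] :
    cs.Alt k B f = (Nat.card (cs.parabolic B) : k)⁻¹ •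
      ∑ w : cs.parabolic B, (((cs.sign (w : W) : ℤˣ) : ℤ) : k) • conj k (w : W) f := by
  simp only [Alt, LinearMap.smul_apply, LinearMap.sum_apply]
  congr 1
  exact Finset.sum_congr (by ext; simp) fun _ _ => rfl

theorem Alt_conj {B : Finset I} {v : W} (hv : v ∈ cs.parabolic B) (f : MonoidAlgebra k W) :
    cs.Alt k B (conj k v f) = (((cs.sign v : ℤˣ) : ℤ) : k) • cs.Alt k B f := by
  classical
  rw [Alt_apply, Alt_apply, smul_comm]
  congr 1
  rw [Finset.smul_sum]
  refine Fintype.sum_equiv (Equiv.mulRight ⟨v, hv⟩) _ _ fun w => ?_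
  rw [Equiv.coe_mulRight, Subgroup.coe_mul, map_mul, CoxeterDynkin.conj_mul, smul_smul,
    Units.val_mul, Int.cast_mul, mul_left_comm, sign_mul_sign, mul_one]

variable [CharZero k]

theorem Alt_eq_zero_of_conj_simple {B : Finset I} {j : I} (hj : j ∈ B) {f : MonoidAlgebra k W}
    (hf : conj k (cs.simple j) f = f) : cs.Alt k B f = 0 := by
  have h := Alt_conj (k := k) (simple_mem_parabolic hj) f (cs := cs)
  rw [hf, sign_simple] at h
  have h2 : (2 : k) • cs.Alt k B f = 0 := by
    rw [two_smul]
    nth_rewrite 1 [h]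
    simp
  exact (smul_eq_zero.1 h2).resolve_left two_ne_zero

theorem Alt_eq_zero_of_mem_fixedPart {B α : Finset I} [DecidableEq I] (hα : α ⊂ B)
    {f : MonoidAlgebra k W} (hf : f ∈ cs.fixedPart k B (B \ α)) : cs.Alt k B f = 0 := by
  obtain ⟨j, hjB, hjα⟩ := Finset.exists_of_ssubset hα
  exact Alt_eq_zero_of_conj_simple hjB
    (hf.2 _ (simple_mem_parabolic (Finset.mem_sdiff.2 ⟨hjB, hjα⟩)))

theorem Alt_Alt {B B' : Finset I} (h : B ⊆ B') (f : MonoidAlgebra k W) :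
    cs.Alt k B' (cs.Alt k B f) = cs.Alt k B' f := by
  classical
  rw [Alt_apply B, map_smul, map_sum]
  have : ∀ w : cs.parabolic B, cs.Alt k B' ((((cs.sign (w : W) : ℤˣ) : ℤ) : k) •
      conj k (w : W) f) = cs.Alt k B' f := fun w => by
    rw [map_smul, Alt_conj (cs.parabolic_mono h w.2), smul_smul, sign_mul_sign, one_smul]
  simp only [this]
  rw [Finset.sum_const, Finset.card_univ, ← Nat.card_eq_fintype_card, ← Nat.cast_smul_eq_nsmul k,
    smul_smul, inv_mul_cancel₀ (Nat.cast_ne_zero.2 Nat.card_pos.ne'), one_smul]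

theorem Alt_of_mem_signPart {B : Finset I} {f : MonoidAlgebra k W} (hf : f ∈ cs.signPart k B) :
    cs.Alt k B f = f := by
  classical
  rw [Alt_apply]
  have : ∀ w : cs.parabolic B, (((cs.sign (w : W) : ℤˣ) : ℤ) : k) • conj k (w : W) f = f :=
    fun w => by rw [hf.2 _ w.2, smul_smul, sign_mul_sign, one_smul]
  simp only [this]
  rw [Finset.sum_const, Finset.card_univ, ← Nat.card_eq_fintype_card, ← Nat.cast_smul_eq_nsmul k,
    smul_smul, inv_mul_cancel₀ (Nat.cast_ne_zero.2 Nat.card_pos.ne'), one_smul]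

end Antisymmetrisation

section DynkinComplex

variable [LinearOrder I]

theorem CDcomp_of_index {p : ℕ} {B α : Finset I}
    (h : M.IsConnectedSubdiagram B ∧ α ⊆ B ∧ α.card = p) (a : CD cs k p) :
    CDcomp cs k p B α a = a ⟨(B, α), h⟩ := by
  rw [CDcomp, dif_pos h]
  rfl

theorem CDcomp_eq_zero {p : ℕ} {B α : Finset I}
    (h : ¬ (M.IsConnectedSubdiagram B ∧ α ⊆ B ∧ α.card = p)) (a : CD cs k p) :
    CDcomp cs k p B α a = 0 := by
  rw [CDcomp, dif_neg h]
  rfl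

theorem CD_ext {p : ℕ} {a a' : CD cs k p}
    (h : ∀ B α, M.IsConnectedSubdiagram B → α ⊆ B → α.card = p →
      CDcomp cs k p B α a = CDcomp cs k p B α a') : a = a' := by
  funext x
  obtain ⟨⟨B, α⟩, hx⟩ := x
  have := h B α hx.1 hx.2.1 hx.2.2
  rw [CDcomp_of_index hx, CDcomp_of_index hx] at this
  exact Subtype.ext this

/-- The cochain with given components. -/
def CDmk (p : ℕ) (f : Finset I → Finset I → MonoidAlgebra k W)
    (hf : ∀ B α, α ⊆ B → f B α ∈ cs.fixedPart k B (B \ α)) : CD cs k p :=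
  fun x => ⟨f x.1.1 x.1.2, hf _ _ x.2.2.1⟩

theorem CDcomp_CDmk {p : ℕ} {f : Finset I → Finset I → MonoidAlgebra k W}
    (hf : ∀ B α, α ⊆ B → f B α ∈ cs.fixedPart k B (B \ α)) {B α : Finset I}
    (h : M.IsConnectedSubdiagram B ∧ α ⊆ B ∧ α.card = p) :
    CDcomp cs k p B α (CDmk p f hf) = f B α := CDcomp_of_index h _

/-- The condition that a component of `B ∖ β` contain `α ∖ β` is automatic when the component of a
cochain is read as zero off the index set. -/
theorem dCDcomp_apply (p : ℕ) (B α : Finset I) (a : CD cs k p) :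
    dCDcomp cs k p B α a = ∑ β ∈ α, boundarySign k α β • (CDcomp cs k p B (α.erase β) a -
      ∑ C ∈ M.components (B.erase β), CDcomp cs k p C (α.erase β) a) := by
  classical
  simp only [dCDcomp, LinearMap.sum_apply, LinearMap.smul_apply, LinearMap.sub_apply, boundarySign]
  refine Finset.sum_congr rfl fun β _ => ?_
  congr 2
  refine Finset.sum_subset (fun C hC => ?_) fun C hC hC' => CDcomp_eq_zero (fun h => hC' ?_) a
  · rw [CoxeterMatrix.mem_components]
    exact (Finset.mem_filter.1 hC).2.1
  · rw [CoxeterMatrix.mem_components] at hC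
    exact Finset.mem_filter.2 ⟨Finset.mem_powerset.2 hC.1, hC, h.2.1⟩

theorem CDcomp_dCD {p : ℕ} {B α : Finset I}
    (h : M.IsConnectedSubdiagram B ∧ α ⊆ B ∧ α.card = p + 1) (a : CD cs k p) :
    CDcomp cs k (p + 1) B α (dCD cs k p a) = dCDcomp cs k p B α a := CDcomp_of_index h _

theorem dCD_comp_dCD (p : ℕ) : cs.dCD k (p + 1) ∘ₗ cs.dCD k p = 0 := by
  classical
  refine LinearMap.ext fun a => CD_ext fun B α hB hα hcard => ?_
  rw [LinearMap.comp_apply, CDcomp_dCD ⟨hB, hα, hcard⟩, LinearMap.zero_apply, map_zero,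
    dCDcomp_apply]
  -- The terms that arise by removing first `β` and then `γ`.
  let E : I → I → MonoidAlgebra k W := fun β γ =>
    CDcomp cs k p B ((α.erase β).erase γ) a -
      ∑ C ∈ M.components (B.erase γ), CDcomp cs k p C ((α.erase β).erase γ) a -
      ∑ C ∈ M.components (B.erase β), if γ ∈ C then CDcomp cs k p C ((α.erase β).erase γ) a -
        ∑ C' ∈ M.components (C.erase γ), CDcomp cs k p C' ((α.erase β).erase γ) a else 0
  rw [← sum_boundarySign_smul_eq_zero (k := k) α E]
  · refine Finset.sum_congr rfl fun β hβ => congrArg _ ?_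
    have hc : (α.erase β).card = p + 1 := by rw [Finset.card_erase_of_mem hβ, hcard]; rfl
    rw [CDcomp_dCD ⟨hB, (Finset.erase_subset _ _).trans hα, hc⟩, dCDcomp_apply]
    simp only [E, smul_sub _ (_ - _) (∑ _ ∈ _, _), Finset.sum_sub_distrib]
    congr 1
    simp only [Finset.smul_sum]
    rw [Finset.sum_comm]
    refine Finset.sum_congr rfl fun C hC => ?_
    rw [CoxeterMatrix.mem_components] at hC
    by_cases hαC : α.erase β ⊆ C
    · rw [CDcomp_dCD ⟨hC.2.1, hαC, hc⟩, dCDcomp_apply]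
      exact Finset.sum_congr rfl fun γ hγ => by rw [if_pos (hαC hγ)]
    · rw [CDcomp_eq_zero fun h => hαC h.2.1]
      obtain ⟨δ, hδ, hδC⟩ := Finset.not_subset.1 hαC
      refine (Finset.sum_eq_zero fun γ _ => ?_).symm
      split_ifs with hγC
      · have hδ' : δ ∈ (α.erase β).erase γ :=
          Finset.mem_erase.2 ⟨fun h => hδC (h ▸ hγC), hδ⟩
        rw [CDcomp_eq_zero fun h => hδC (h.2.1 hδ'), Finset.sum_eq_zero, sub_zero, smul_zero]
        intro C' hC'
        rw [CoxeterMatrix.mem_components] at hC'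
        exact CDcomp_eq_zero
          (fun h => hδC (Finset.mem_of_mem_erase (hC'.1 (h.2.1 hδ')))) a
      · rw [smul_zero]
  · have hE : ∀ β ∈ α, ∀ γ ∈ α, β ≠ γ → E β γ =
        CDcomp cs k p B ((α.erase β).erase γ) a -
          ∑ C ∈ M.components (B.erase γ), CDcomp cs k p C ((α.erase β).erase γ) a -
          ∑ C ∈ M.components (B.erase β), CDcomp cs k p C ((α.erase β).erase γ) a +
          ∑ C ∈ M.components ((B.erase β).erase γ),
            CDcomp cs k p C ((α.erase β).erase γ) a := by
      intro β _ γ hγ hne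
      rw [CoxeterMatrix.sum_components_erase (Finset.mem_erase.2 ⟨hne.symm, hα hγ⟩),
        sub_add, ← Finset.sum_sub_distrib]
      simp only [E]
      congr 1
      refine Finset.sum_congr rfl fun C _ => ?_
      split_ifs
      · rfl
      · rw [sub_self]
    intro β hβ γ hγ hne
    rw [hE β hβ γ hγ hne, hE γ hγ β hβ hne.symm, Finset.erase_right_comm (s := α),
      Finset.erase_right_comm (s := B)]
    abel

/-- At `(C; X)` with `C` a component of `X` a cochain has a component only if `C = X`; both sides
are zero if `X` is disconnected. -/
theorem sum_components_CDcomp_self (p : ℕ) (X : Finset I) (a : CD cs k p) :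
    ∑ C ∈ M.components X, CDcomp cs k p C X a = CDcomp cs k p X X a := by
  refine Finset.sum_eq_single X (fun C hC hne => CDcomp_eq_zero (fun h => hne ?_) a)
    fun hX => CDcomp_eq_zero (fun h => hX ?_) a
  · exact (CoxeterMatrix.mem_components.1 hC).1.antisymm h.2.1
  · exact CoxeterMatrix.mem_components.2 ⟨subset_rfl, h.1, fun i _ j hj hj' => absurd hj hj'⟩

end DynkinComplex

section AlternatingComplex

theorem HCcomp_of_index {p : ℕ} {B : Finset I}
    (h : M.IsConnectedSubdiagram B ∧ B.card = p) (b : HC cs k p) :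
    HCcomp cs k p B b = b ⟨B, h⟩ := by
  rw [HCcomp, dif_pos h]
  rfl

theorem HCcomp_eq_zero {p : ℕ} {B : Finset I}
    (h : ¬ (M.IsConnectedSubdiagram B ∧ B.card = p)) (b : HC cs k p) :
    HCcomp cs k p B b = 0 := by
  rw [HCcomp, dif_neg h]
  rfl

theorem HC_ext {p : ℕ} {b b' : HC cs k p}
    (h : ∀ B, M.IsConnectedSubdiagram B → B.card = p →
      HCcomp cs k p B b = HCcomp cs k p B b') : b = b' := by
  funext x
  obtain ⟨B, hx⟩ := x
  have := h B hx.1 hx.2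
  rw [HCcomp_of_index hx, HCcomp_of_index hx] at this
  exact Subtype.ext this

variable [LinearOrder I] [Fintype W]

theorem dHCcomp_apply (p : ℕ) (B : Finset I) (b : HC cs k p) :
    dHCcomp cs k p B b =
      -∑ β ∈ B, boundarySign k B β • cs.Alt k B (HCcomp cs k p (B.erase β) b) := by
  simp only [dHCcomp, LinearMap.sum_apply, LinearMap.smul_apply, LinearMap.comp_apply,
    ← Finset.sum_neg_distrib, ← neg_smul]
  refine Finset.sum_congr rfl fun β hβ => ?_
  have : B.filter (· ≤ β) = insert β (B.filter (· < β)) := by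
    ext x
    simp only [Finset.mem_filter, Finset.mem_insert, le_iff_lt_or_eq]
    constructor
    · rintro ⟨h1, h2 | h2⟩
      exacts [Or.inr ⟨h1, h2⟩, Or.inl h2]
    · rintro (h | h)
      exacts [⟨h ▸ hβ, Or.inr h⟩, ⟨h.1, Or.inl h.2⟩]
  rw [this, Finset.card_insert_of_notMem (by simp), pow_succ, mul_neg_one, boundarySign]

theorem HCcomp_dHC {p : ℕ} {B : Finset I}
    (h : M.IsConnectedSubdiagram B ∧ B.card = p + 1) (b : HC cs k p) :
    HCcomp cs k (p + 1) B (dHC cs k p b) = dHCcomp cs k p B b := HCcomp_of_index h _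

variable [CharZero k]

/-- If `B ∖ β` is disconnected, then `γ` is isolated in it or `B ∖ {β, γ}` is disconnected, too; in
both cases the component at `B ∖ {β, γ}` does not contribute. -/
theorem Alt_HCcomp_eq_zero {p : ℕ} {B : Finset I} {β γ : I} (hγ : γ ∈ B.erase β)
    (h : ¬ M.IsConnectedSubdiagram (B.erase β)) (b : HC cs k p) :
    cs.Alt k B (HCcomp cs k p ((B.erase β).erase γ) b) = 0 := by
  by_cases hA : M.IsConnectedSubdiagram ((B.erase β).erase γ)
  · refine Alt_eq_zero_of_conj_simple (Finset.mem_of_mem_erase hγ)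
      (conj_eq_self_of_commute (cs.commute_parabolic fun i hi hadj => h ?_)
        (HCcomp_mem cs k p _ b).1)
    rw [← Finset.insert_erase hγ]
    exact hA.insert_of_adj hi hadj
  · rw [HCcomp_eq_zero fun h => hA h.1, map_zero]

theorem dHC_comp_dHC (p : ℕ) : cs.dHC k (p + 1) ∘ₗ cs.dHC k p = 0 := by
  refine LinearMap.ext fun b => HC_ext fun B hB hcard => ?_
  rw [LinearMap.comp_apply, HCcomp_dHC ⟨hB, hcard⟩, LinearMap.zero_apply, map_zero,
    dHCcomp_apply, neg_eq_zero, ← neg_eq_zero,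
    ← sum_boundarySign_smul_eq_zero (k := k) B
      (fun β γ => cs.Alt k B (HCcomp cs k p ((B.erase β).erase γ) b))
      fun β _ γ _ _ => by rw [Finset.erase_right_comm], ← Finset.sum_neg_distrib]
  refine Finset.sum_congr rfl fun β hβ => ?_
  have hc : (B.erase β).card = p + 1 := by rw [Finset.card_erase_of_mem hβ, hcard]; rfl
  rw [← smul_neg]
  congr 1
  by_cases hBβ : M.IsConnectedSubdiagram (B.erase β)
  · rw [HCcomp_dHC ⟨hBβ, hc⟩, dHCcomp_apply, map_neg, neg_neg, map_sum]
    refine Finset.sum_congr rfl fun γ _ => ?_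
    rw [map_smul, Alt_Alt (Finset.erase_subset _ _)]
  · rw [HCcomp_eq_zero fun h => hBβ h.1, map_zero, neg_zero]
    exact (Finset.sum_eq_zero fun γ hγ => by rw [Alt_HCcomp_eq_zero hγ hBβ, smul_zero]).symm

end AlternatingComplex

section Comparison

variable [LinearOrder I] [Fintype W]

theorem HCcomp_phi (p : ℕ) (B : Finset I) (a : CD cs k p) :
    HCcomp cs k p B (phi cs k p a) = cs.Alt k B (CDcomp cs k p B B a) := by
  by_cases h : M.IsConnectedSubdiagram B ∧ B.card = p
  · exact HCcomp_of_index h _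
  · rw [HCcomp_eq_zero h, CDcomp_eq_zero fun h' => h ⟨h'.1, h'.2.2⟩, map_zero]

variable [CharZero k]

theorem phi_comp_dCD (p : ℕ) : cs.phi k (p + 1) ∘ₗ cs.dCD k p = cs.dHC k p ∘ₗ cs.phi k p := by
  refine LinearMap.ext fun a => HC_ext fun B hB hcard => ?_
  rw [LinearMap.comp_apply, LinearMap.comp_apply, HCcomp_phi, CDcomp_dCD ⟨hB, subset_rfl, hcard⟩,
    HCcomp_dHC ⟨hB, hcard⟩, dCDcomp_apply, dHCcomp_apply, map_sum, ← Finset.sum_neg_distrib]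
  refine Finset.sum_congr rfl fun β hβ => ?_
  rw [map_smul, map_sub, sum_components_CDcomp_self, HCcomp_phi,
    Alt_Alt (Finset.erase_subset _ _), Alt_eq_zero_of_mem_fixedPart (Finset.erase_ssubset hβ)
      (CDcomp_mem cs k p B _ a), zero_sub, smul_neg]

theorem phi_surjective (p : ℕ) : Function.Surjective (cs.phi k p) := by
  classical
  intro b
  have hf : ∀ B α : Finset I, α ⊆ B →
      (if α = B then HCcomp cs k p B b else 0) ∈ cs.fixedPart k B (B \ α) := by
    intro B α _
    split_ifs with h
    · subst h
      refine ⟨(HCcomp_mem cs k p α b).1, conj_fixed_of_closure ?_⟩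
      rintro _ ⟨j, hj, rfl⟩
      simp at hj
    · exact zero_mem _
  refine ⟨CDmk p _ hf, HC_ext fun B hB hcard => ?_⟩
  rw [HCcomp_phi, CDcomp_CDmk hf ⟨hB, subset_rfl, hcard⟩, if_pos rfl,
    Alt_of_mem_signPart (HCcomp_mem cs k p B b)]

end Comparison

end CoxeterSystem

/-! ### Acyclicity of the kernel of the comparison map -/

namespace CoxeterSystem
open CoxeterDynkin

variable {I : Type*} [LinearOrder I] {W : Type*} [Group W] {M : CoxeterMatrix I}
variable {cs : CoxeterSystem M W} {k : Type*} [Field k]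

section Acyclicity

/-- On subdiagrams with `n` vertices, a cochain that vanishes on all smaller subdiagrams has the
coboundary of the Coxeter complex as its Dynkin differential. -/
theorem dCDcomp_of_vanishing {p n : ℕ} {a : CD cs k p}
    (ha : ∀ B α, B.card < n → CDcomp cs k p B α a = 0) {B : Finset I} (hB : B.card ≤ n)
    {α : Finset I} (hα : α ⊆ B) :
    dCDcomp cs k p B α a = coboundary k (fun γ => CDcomp cs k p B γ a) α := by
  rw [dCDcomp_apply, coboundary_apply]
  refine Finset.sum_congr rfl fun β hβ => ?_
  rw [Finset.sum_eq_zero, sub_zero]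
  intro C hC
  refine ha C _ (lt_of_le_of_lt (Finset.card_le_card (CoxeterMatrix.mem_components.1 hC).1)
    (lt_of_lt_of_le ?_ hB))
  exact Finset.card_lt_card (Finset.erase_ssubset (hα hβ))

variable [Fintype W] [CharZero k]

/-- The lowest part of a cocycle in the kernel of `φ` is a coboundary in the Coxeter complex of
each of its subdiagrams. -/
theorem exists_coboundary_of_vanishing {p n : ℕ} {a : CD cs k p} (hda : dCD cs k p a = 0)
    (hφ : phi cs k p a = 0) (ha : ∀ B α, B.card < n → CDcomp cs k p B α a = 0) {B : Finset I}
    (hB : B.card = n) :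
    ∃ b : Finset I → MonoidAlgebra k W, (∀ γ ⊆ B, b γ ∈ cs.fixedPart k B (B \ γ)) ∧ b B = 0 ∧
      ∀ α ⊆ B, coboundary k b α = CDcomp cs k p B α a := by
  by_cases hBc : M.IsConnectedSubdiagram B
  · refine exists_coboundary_of_Alt_eq_zero cs (fun α _ => CDcomp_mem cs k p B α a)
      (fun α hα => ?_) ?_
    · by_cases hc : α.card = p + 1
      · rw [← dCDcomp_of_vanishing ha hB.le hα, ← CDcomp_dCD ⟨hBc, hα, hc⟩, hda, map_zero]
      · rw [coboundary_apply]
        refine Finset.sum_eq_zero fun β hβ => ?_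
        rw [CDcomp_eq_zero, smul_zero]
        rintro ⟨-, -, h⟩
        exact hc (by rw [← h, Finset.card_erase_add_one hβ])
    · rw [← HCcomp_phi, hφ, map_zero]
  · refine ⟨0, fun _ _ => zero_mem _, rfl, fun α _ => ?_⟩
    rw [map_zero, Pi.zero_apply, CDcomp_eq_zero fun h => hBc h.1]

theorem eq_zero_of_dCD_eq_zero_of_phi_eq_zero {a : CD cs k 0} (hda : dCD cs k 0 a = 0)
    (hφ : phi cs k 0 a = 0) : a = 0 := by
  have key : ∀ n : ℕ, ∀ B α, B.card < n → CDcomp cs k 0 B α a = 0 := by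
    intro n
    induction n with
    | zero => exact fun B α h => absurd h (Nat.not_lt_zero _)
    | succ n ih =>
      intro B α hB
      rcases Nat.lt_succ_iff_lt_or_eq.1 hB with hB | hB
      · exact ih B α hB
      · by_cases h : M.IsConnectedSubdiagram B ∧ α ⊆ B ∧ α.card = 0
        · obtain ⟨b, -, -, hb⟩ := exists_coboundary_of_vanishing hda hφ ih hB
          rw [← hb α h.2.1, Finset.card_eq_zero.1 h.2.2, coboundary_apply, Finset.sum_empty]
        · exact CDcomp_eq_zero h a
  exact CD_ext fun B α _ _ _ => by rw [key _ B α (Nat.lt_succ_self _), map_zero]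

variable [Fintype I]

/-- The kernel of `φ` is acyclic. -/
theorem exists_dCD_eq_of_phi_eq_zero {p : ℕ} {a : CD cs k (p + 1)}
    (hda : dCD cs k (p + 1) a = 0) (hφ : phi cs k (p + 1) a = 0) :
    ∃ b : CD cs k p, dCD cs k p b = a ∧ phi cs k p b = 0 := by
  have hdd := fun b : CD cs k p => LinearMap.congr_fun (dCD_comp_dCD (cs := cs) (k := k) p) b
  have hφd := fun b : CD cs k p => LinearMap.congr_fun (phi_comp_dCD (cs := cs) (k := k) p) b
  simp only [LinearMap.comp_apply, LinearMap.zero_apply] at hdd hφd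
  have key : ∀ n : ℕ, ∃ b : CD cs k p, phi cs k p b = 0 ∧
      ∀ B α, B.card < n → CDcomp cs k (p + 1) B α (a - dCD cs k p b) = 0 := by
    intro n
    induction n with
    | zero => exact ⟨0, map_zero _, fun B α h => absurd h (Nat.not_lt_zero _)⟩
    | succ n ih =>
      obtain ⟨b, hbφ, hb⟩ := ih
      have hstep : ∀ B : Finset I, B.card = n → ∃ c : Finset I → MonoidAlgebra k W,
          (∀ γ ⊆ B, c γ ∈ cs.fixedPart k B (B \ γ)) ∧ c B = 0 ∧
          ∀ α ⊆ B, coboundary k c α = CDcomp cs k (p + 1) B α (a - dCD cs k p b) := fun B hB =>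
        exists_coboundary_of_vanishing (by rw [map_sub, hda, hdd, sub_zero])
          (by rw [map_sub, hφ, hφd, hbφ, map_zero, sub_zero]) hb hB
      choose! c hcmem hctop hc using hstep
      -- The correction lives on the subdiagrams with `n` vertices.
      have hf : ∀ B α : Finset I, α ⊆ B →
          (if B.card = n then c B α else 0) ∈ cs.fixedPart k B (B \ α) := by
        intro B α hα
        split_ifs with h
        · exact hcmem B h α hα
        · exact zero_mem _
      let b' : CD cs k p := CDmk p _ hf
      have hb' : ∀ B α, M.IsConnectedSubdiagram B ∧ α ⊆ B ∧ α.card = p →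
          CDcomp cs k p B α b' = if B.card = n then c B α else 0 := fun B α h => CDcomp_CDmk hf h
      have hb'lt : ∀ B α, B.card < n → CDcomp cs k p B α b' = 0 := by
        intro B α hB
        by_cases h : M.IsConnectedSubdiagram B ∧ α ⊆ B ∧ α.card = p
        · rw [hb' B α h, if_neg hB.ne]
        · exact CDcomp_eq_zero h _
      refine ⟨b + b', ?_, fun B α hB => ?_⟩
      · rw [map_add, hbφ, zero_add]
        refine HC_ext fun B hBc hcard => ?_
        rw [HCcomp_phi, hb' B B ⟨hBc, subset_rfl, hcard⟩, map_zero]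
        split_ifs with h
        · rw [hctop B h, map_zero]
        · rw [map_zero]
      · by_cases h : M.IsConnectedSubdiagram B ∧ α ⊆ B ∧ α.card = p + 1
        swap
        · exact CDcomp_eq_zero h _
        have hBn : B.card ≤ n := Nat.lt_succ_iff.1 hB
        rw [map_add, ← sub_sub, map_sub, CDcomp_dCD h b', dCDcomp_of_vanishing hb'lt hBn h.2.1]
        have hcoe : ∀ β ∈ α, CDcomp cs k p B (α.erase β) b' =
            if B.card = n then c B (α.erase β) else 0 := fun β hβ =>
          hb' B _ ⟨h.1, (Finset.erase_subset _ _).trans h.2.1, by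
            rw [Finset.card_erase_of_mem hβ, h.2.2]; rfl⟩
        rw [coboundary_apply, Finset.sum_congr rfl fun β hβ => by rw [hcoe β hβ]]
        rcases hBn.lt_or_eq with hlt | heq
        · simp only [if_neg hlt.ne, smul_zero, Finset.sum_const_zero, sub_zero]
          exact hb B α hlt
        · simp only [if_pos heq]
          rw [← coboundary_apply, hc B heq α h.2.1, sub_self]
  obtain ⟨b, hbφ, hb⟩ := key (Fintype.card I + 1)
  refine ⟨b, ?_, hbφ⟩
  rw [eq_comm, ← sub_eq_zero]
  exact CD_ext fun B α _ _ _ => by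
    rw [hb B α (Nat.lt_succ_of_le (Finset.card_le_univ B)), map_zero]

end Acyclicity

end CoxeterSystem

/-! ### Quasi-isomorphisms of complexes of vector spaces -/

section QuasiIso

universe u v

variable {k : Type u} [Field k]

/-- If every value of a linear map `x` is the value of `d` at an element of the kernel of `f`, then
these elements can be chosen linearly. -/
theorem exists_linear_lift {A X Y Z : Type*} [AddCommGroup A] [Module k A] [AddCommGroup X]
    [Module k X] [AddCommGroup Y] [Module k Y] [AddCommGroup Z] [Module k Z]
    (d : X →ₗ[k] Y) (f : X →ₗ[k] Z) (x : A →ₗ[k] Y) (h : ∀ a, ∃ b, d b = x a ∧ f b = 0) :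
    ∃ g : A →ₗ[k] X, (∀ a, d (g a) = x a) ∧ ∀ a, f (g a) = 0 := by
  let d' : LinearMap.ker f →ₗ[k] Y := d ∘ₗ (LinearMap.ker f).subtype
  have hx : ∀ a, x a ∈ LinearMap.range d' := fun a => by
    obtain ⟨b, hb, hb'⟩ := h a
    exact ⟨⟨b, hb'⟩, hb⟩
  obtain ⟨g, hg⟩ := Module.projective_lifting_property d'.rangeRestrict (x.codRestrict _ hx)
    d'.surjective_rangeRestrict
  exact ⟨(LinearMap.ker f).subtype ∘ₗ g,
    fun a => congrArg Subtype.val (LinearMap.congr_fun hg a), fun a => (g a).2⟩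

/-- A surjective morphism of cochain complexes of vector spaces with acyclic kernel is a
quasi-isomorphism. -/
theorem quasiIso_of_surjective_of_acyclic_ker {K L : CochainComplex (ModuleCat.{v} k) ℕ}
    (φ : K ⟶ L) (hφ : ∀ n, Function.Surjective (φ.f n).hom)
    (h0 : ∀ a : K.X 0, (K.d 0 1).hom a = 0 → (φ.f 0).hom a = 0 → a = 0)
    (h : ∀ n, ∀ a : K.X (n + 1), (K.d (n + 1) (n + 1 + 1)).hom a = 0 → (φ.f (n + 1)).hom a = 0 →
      ∃ b : K.X n, (K.d n (n + 1)).hom b = a ∧ (φ.f n).hom b = 0) : QuasiIso φ := by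
  have hcomm : ∀ i j (x : K.X i), (L.d i j).hom ((φ.f i).hom x) = (φ.f j).hom ((K.d i j).hom x) :=
    fun i j x => by
      have := congrArg (fun g => g.hom x) (φ.comm i j)
      exact this
  have hdd : ∀ i j l (x : K.X i), (K.d j l).hom ((K.d i j).hom x) = 0 := fun i j l x => by
    have := congrArg (fun g => g.hom x) (K.d_comp_d i j l)
    exact this
  have hlift : ∀ n (A : ModuleCat.{v} k) (y : A ⟶ L.X n), ∃ u : A ⟶ K.X n, u ≫ φ.f n = y := by
    intro n A y
    obtain ⟨u, hu⟩ := Module.projective_lifting_property (φ.f n).hom y.hom (hφ n)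
    exact ⟨ModuleCat.ofHom u, ModuleCat.hom_ext hu⟩
  refine ⟨fun n => ?_⟩
  rw [quasiIsoAt_iff_isIso_homologyMap]
  have hmono : Mono (HomologicalComplex.homologyMap φ n) := by
    rcases n with _ | n
    · rw [HomologicalComplex.mono_homologyMap_iff_up_to_refinements φ 0 0 1 (by simp) (by simp)]
      intro A x hx y hy
      rw [L.shape 0 0 (by simp), Limits.comp_zero] at hy
      have hx0 : x = 0 := by
        refine ModuleCat.hom_ext (LinearMap.ext fun a => h0 _ ?_ ?_)
        · exact congrArg (fun g => g.hom a) hx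
        · exact congrArg (fun g => g.hom a) hy
      exact ⟨A, 𝟙 A, inferInstance, 0, by rw [hx0, Limits.comp_zero, Limits.zero_comp]⟩
    · rw [HomologicalComplex.mono_homologyMap_iff_up_to_refinements φ n (n + 1) (n + 1 + 1)
        (by simp) (by simp)]
      intro A x hx y hy
      obtain ⟨u, rfl⟩ := hlift n A y
      obtain ⟨g, hg, -⟩ := exists_linear_lift (K.d n (n + 1)).hom (φ.f n).hom
        (x - u ≫ K.d n (n + 1)).hom fun a => h n _ (by
          have hx' : (K.d (n + 1) (n + 1 + 1)).hom (x.hom a) = 0 :=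
            congrArg (fun g => g.hom a) hx
          change (K.d (n + 1) (n + 1 + 1)).hom (x.hom a - (K.d n (n + 1)).hom (u.hom a)) = 0
          rw [map_sub, hx', hdd, sub_zero]) (by
          have hy' : (φ.f (n + 1)).hom (x.hom a) = (L.d n (n + 1)).hom ((φ.f n).hom (u.hom a)) :=
            congrArg (fun g => g.hom a) hy
          change (φ.f (n + 1)).hom (x.hom a - (K.d n (n + 1)).hom (u.hom a)) = 0
          rw [map_sub, hy', hcomm, sub_self])
      refine ⟨A, 𝟙 A, inferInstance, u + ModuleCat.ofHom g, ?_⟩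
      have hg' : ModuleCat.ofHom g ≫ K.d n (n + 1) = x - u ≫ K.d n (n + 1) :=
        ModuleCat.hom_ext (LinearMap.ext hg)
      rw [Preadditive.add_comp, hg', Category.id_comp, add_sub_cancel]
  have hepi : Epi (HomologicalComplex.homologyMap φ n) := by
    rw [HomologicalComplex.epi_homologyMap_iff_up_to_refinements φ _ n (n + 1) rfl (by simp)]
    intro A y hy
    obtain ⟨u, rfl⟩ := hlift n A y
    obtain ⟨g, hg, hgφ⟩ := exists_linear_lift (K.d n (n + 1)).hom (φ.f n).hom
      (u ≫ K.d n (n + 1)).hom fun a => h n _ (hdd _ _ _ _) (by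
        have hy' : (L.d n (n + 1)).hom ((φ.f n).hom (u.hom a)) = 0 :=
          congrArg (fun g => g.hom a) hy
        change (φ.f (n + 1)).hom ((K.d n (n + 1)).hom (u.hom a)) = 0
        rw [← hcomm, hy'])
    have hg' : ModuleCat.ofHom g ≫ K.d n (n + 1) = u ≫ K.d n (n + 1) :=
      ModuleCat.hom_ext (LinearMap.ext hg)
    have hgφ' : ModuleCat.ofHom g ≫ φ.f n = 0 := ModuleCat.hom_ext (LinearMap.ext hgφ)
    refine ⟨A, 𝟙 A, inferInstance, u - ModuleCat.ofHom g, ?_, 0, ?_⟩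
    · rw [Preadditive.sub_comp, hg', sub_self]
    · rw [Preadditive.sub_comp, hgφ', sub_zero, Limits.zero_comp, add_zero, Category.id_comp]
  exact isIso_of_mono_of_epi _

end QuasiIso

end

/-- On every component `(B; α)` of the Dynkin complex with `α ≠ B` antisymmetrisation vanishes,
so that `φ` preserves degrees; `CD` and `HC` are complexes, `φ` is a morphism of complexes, and it
is a quasi-isomorphism. -/
theorem mainTheorem2 {I : Type*} [Fintype I] [LinearOrder I] {W : Type*} [Group W] [Fintype W]
    {M : CoxeterMatrix I} (cs : CoxeterSystem M W) (k : Type*) [Field k] [CharZero k] :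
    (∀ B α : Finset I, M.IsConnectedSubdiagram B → α ⊂ B →
      ∀ a ∈ cs.fixedPart k B (B \ α), cs.Alt k B a = 0) ∧
    ∃ (hCD : ∀ p : ℕ, cs.dCD k (p + 1) ∘ₗ cs.dCD k p = 0)
      (hHC : ∀ p : ℕ, cs.dHC k (p + 1) ∘ₗ cs.dHC k p = 0)
      (hφ : ∀ p : ℕ, cs.phi k (p + 1) ∘ₗ cs.dCD k p = cs.dHC k p ∘ₗ cs.phi k p),
      QuasiIso (cs.phiHom k hCD hHC hφ) := by
  refine ⟨fun B α _ hα a ha => CoxeterSystem.Alt_eq_zero_of_mem_fixedPart hα ha,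
    CoxeterSystem.dCD_comp_dCD, CoxeterSystem.dHC_comp_dHC, CoxeterSystem.phi_comp_dCD, ?_⟩
  have hd : ∀ p, ((CoxeterSystem.CDcomplex cs k CoxeterSystem.dCD_comp_dCD).d p (p + 1)) =
      ModuleCat.ofHom (cs.dCD k p) := fun p =>
    CochainComplex.of_d (fun p => ModuleCat.of k (CoxeterSystem.CD cs k p))
      (fun p => ModuleCat.ofHom (cs.dCD k p)) p
  refine quasiIso_of_surjective_of_acyclic_ker _ (fun n => CoxeterSystem.phi_surjective n)
    (fun a hda hφ => ?_) (fun n a hda hφ => ?_)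
  · rw [hd 0] at hda
    exact CoxeterSystem.eq_zero_of_dCD_eq_zero_of_phi_eq_zero hda hφ
  · rw [hd (n + 1)] at hda
    rw [hd n]
    exact CoxeterSystem.exists_dCD_eq_of_phi_eq_zero hda hφ
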